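/- Let $\Omega\subset\mathbb{R}^n$, $n\in\{2,3\}$, be a bounded Lipschitz domain, let $M\ge 2$, and let $E_1,\dots,E_M\subset\partial\Omega$ (the extended electrodes) be nonempty, relatively open, connected and mutually disjoint. Let $\chi_m$ be the characteristic function of $E_m$, and identify $V\in\mathbb{C}^M$ with the function $\sum_m V_m\chi_m$ on $\partial\Omega$. Let $L^\infty(E)$ be the space of those functions in $L^\infty(\partial\Omega)$ that vanish almost everywhere (with respect to surface measure) outside $\bigcup_m E_m$. Put $\mathbb{C}^M_\diamond=\{J\in\mathbb{C}^M : \sum_m J_m=0\}$ and let $\mathcal{H}^1$ be the quotient of $H^1(\Omega)\oplus\mathbb{C}^M$ by $\{(c,c\mathbf 1): c\in\mathbb{C}\}$, $\mathbf 1=(1,\dots,1)$, with the norm $$\|(v,V)\|_{\mathcal{H}^1}=\inf_{c\in\mathbb{C}}\big(\|v-c\|_{H^1(\Omega)}^2+\|V-c\mathbf 1\|_2^2\big)^{1/2};$$ write $\|V\|_{\mathbb{C}^M/\mathbb{C}}=\inf_{c\in\mathbb C}\|V-c\mathbf 1\|_2$. For $\sigma\in L^\infty(\Omega)$ and $\zeta\in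 L^\infty(E)$ (complex-valued) let $$B_{\sigma,\zeta}\big((w,W),(v,V)\big)=\int_\Omega\sigma\nabla w\cdot\nabla\overline v\,dx+\int_{\partial\Omega}\zeta(W-w)(\overline V-\overline v)\,dS .$$ Let $\mathcal{S}=\{\sigma\in L^\infty(\Omega):\operatorname{ess\,inf}\operatorname{Re}\sigma>0\}$, and let $\mathcal{Z}'$ be the set of all $\zeta\in L^\infty(E)$ such that for every $\sigma\in\mathcal{S}$ there is $c=c(\sigma,\zeta)>0$ with $\operatorname{Re}B_{\sigma,\zeta}((v,V),(v,V))\ge c\,\|(v,V)\|_{\mathcal{H}^1}^2$ for all $(v,V)\in\mathcal{H}^1$. For every $(\sigma,\zeta,I)\in\mathcal{S}\times\mathcal{Z}'\times\mathbb{C}^M_\diamond$ there is a unique $(u,U)\in\mathcal{H}^1$ with $B_{\sigma,\zeta}((u,U),(v,V))=I\cdot\overline V$ for all $(v,V)\in\mathcal{H}^1$; let $U(\sigma,\zeta,I)\in\mathbb{C}^M_\diamond$ be its second component, normalized to have zero mean. Then the measurement map $$U:\ \mathcal{S}\times\mathcal{Z}'\times\mathbb{C}^M_\diamond\to\mathbb{C}^M_\diamond,\qquad(\sigma,\zeta,I)\mapsto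 U(\sigma,\zeta,I),$$ is continuous (with respect to the $L^\infty$ and Euclidean norms). More precisely, for every $(\sigma,\zeta)\in\mathcal{S}\times\mathcal{Z}'$ there are $\delta>0$ and $C>0$, depending only on $\Omega,E_1,\dots,E_M,\sigma,\zeta$, such that for all $\omega\in L^\infty(\Omega)$ and $\eta\in L^\infty(E)$ with $\|\omega\|_{L^\infty(\Omega)},\|\eta\|_{L^\infty(E)}\le\delta$ and all $I,J\in\mathbb{C}^M_\diamond$, the problem with parameters $(\sigma+\omega,\zeta+\eta,I+J)$ is also uniquely solvable in $\mathcal{H}^1$, and the difference $(w,W)$ of its solution and the solution for $(\sigma,\zeta,I)$ satisfies $$\|W\|_{\mathbb{C}^M/\mathbb{C}}\le\|(w,W)\|_{\mathcal{H}^1}\le C\big(\|J\|_2+\max\{\|\omega\|_{L^\infty(\Omega)},\|\eta\|_{L^\infty(E)}\}\|I\|_2\big),$$ and likewise $$\|U(\sigma+\omega,\zeta+\eta,I+J)-U(\sigma,\zeta,I)\|_2\le C\big(\|J\|_2+\max\{\|\omega\|_{L^\infty(\Omega)},\|\eta\|_{L^\infty(E)}\}\|I\|_2\big),$$ where $U(\sigma+\omega,\zeta+\eta,I+J)$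 again denotes the zero-mean electrode component of the solution. -/

import Mathlib

open MeasureTheory Set Filter Topology
open scoped ENNReal NNReal

noncomputable section

namespace EIT

/-- Euclidean space `ℝⁿ`. -/
abbrev Rn (n : ℕ) : Type := EuclideanSpace ℝ (Fin n)

/-- The space `ℂᵐ` with the Euclidean norm `‖·‖₂`. -/
abbrev Cn (m : ℕ) : Type := EuclideanSpace ℂ (Fin m)

/-- A bounded Lipschitz domain: a bounded, nonempty, connected open set which, near each of its
boundary points and for a suitable unit direction `ν`, is the strict epigraph (in direction `ν`)
of a Lipschitz function of the coordinates orthogonal to `ν`. -/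
structure IsBoundedLipschitzDomain {n : ℕ} (Ω : Set (Rn n)) : Prop where
  isOpen : IsOpen Ω
  isConnected : IsConnected Ω
  isBounded : Bornology.IsBounded Ω
  lipschitz_boundary : ∀ x₀ ∈ frontier Ω, ∃ (ν : Rn n) (K : ℝ≥0) (g : Rn n → ℝ),
    ‖ν‖ = 1 ∧ LipschitzWith K g ∧ (∀ (x : Rn n) (t : ℝ), g (x + t • ν) = g x) ∧
      ∀ᶠ x in 𝓝 x₀, (x ∈ Ω ↔ g x < inner ℝ ν x)

/-- Lebesgue measure on `Ω`. -/
abbrev vol {n : ℕ} (Ω : Set (Rn n)) : Measure (Rn n) := volume.restrict Ω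

/-- The surface measure `dS` on `∂Ω`: the `(n-1)`-dimensional Hausdorff measure, in the Euclidean
normalization, restricted to the boundary. -/
abbrev surf {n : ℕ} (Ω : Set (Rn n)) : Measure (Rn n) := (μHE[n - 1]).restrict (frontier Ω)

/-- The `i`-th partial derivative at `x` of a function on `ℝⁿ`. -/
def partialDeriv {n : ℕ} {F : Type*} [NormedAddCommGroup F] [NormedSpace ℝ F]
    (φ : Rn n → F) (i : Fin n) (x : Rn n) : F :=
  fderiv ℝ φ x (EuclideanSpace.single i 1)

/-- `g` is the weak gradient of `u` in `Ω`. -/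
def IsWeakGradient {n : ℕ} (Ω : Set (Rn n)) (u : Rn n → ℂ) (g : Rn n → Cn n) : Prop :=
  ∀ φ : Rn n → ℝ, ContDiff ℝ (⊤ : ℕ∞) φ → HasCompactSupport φ → tsupport φ ⊆ Ω →
    ∀ i : Fin n, ∫ x in Ω, partialDeriv φ i x • u x = -∫ x in Ω, φ x • g x i

/-- Pairs `(u, g)` in `L²(Ω) × L²(Ω)ⁿ`, with norm `(‖u‖² + ‖g‖²)^{1/2}`. -/
abbrev L2Pair {n : ℕ} (Ω : Set (Rn n)) : Type :=
  WithLp 2 (Lp ℂ 2 (vol Ω) × Lp (Cn n) 2 (vol Ω))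

lemma integrable_smul_of_test {n : ℕ} {Ω : Set (Rn n)} {φ : Rn n → ℝ} (hc : Continuous φ)
    (hs : HasCompactSupport φ) {u : Rn n → ℂ} (hu : MemLp u 2 (vol Ω)) :
    Integrable (fun x => φ x • u x) (vol Ω) := by
  have h1 : MemLp φ 2 (vol Ω) := hc.memLp_of_hasCompactSupport hs
  exact memLp_one_iff_integrable.mp (hu.smul h1)

lemma memLp_coord {n : ℕ} {Ω : Set (Rn n)} (g : Lp (Cn n) 2 (vol Ω)) (i : Fin n) :
    MemLp (fun x => g x i) 2 (vol Ω) :=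
  (EuclideanSpace.proj (𝕜 := ℂ) i : Cn n →L[ℂ] ℂ).comp_memLp' (Lp.memLp g)

lemma continuous_partialDeriv {n : ℕ} {φ : Rn n → ℝ} (h : ContDiff ℝ (⊤ : ℕ∞) φ) (i : Fin n) :
    Continuous (partialDeriv φ i) :=
  (h.continuous_fderiv (by simp)).clm_apply continuous_const

lemma hasCompactSupport_partialDeriv {n : ℕ} {φ : Rn n → ℝ} (h : HasCompactSupport φ)
    (i : Fin n) : HasCompactSupport (partialDeriv φ i) :=
  h.fderiv_apply (𝕜 := ℝ) _

/-- The Sobolev space `H¹(Ω)` of complex-valued functions, as the space of pairs `(u, ∇u)` of an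
`L²` function and its weak gradient; the norm is `(‖u‖²_{L²} + ‖∇u‖²_{L²})^{1/2}`. -/
def H1 {n : ℕ} (Ω : Set (Rn n)) : Submodule ℂ (L2Pair Ω) where
  carrier := {p | IsWeakGradient Ω p.fst p.snd}
  zero_mem' := by
    intro φ _ _ _ i
    have h1 : (fun x => partialDeriv φ i x • (0 : Lp ℂ 2 (vol Ω)) x) =ᵐ[vol Ω] fun _ => 0 := by
      filter_upwards [Lp.coeFn_zero ℂ 2 (vol Ω)] with x hx
      rw [hx, Pi.zero_apply, smul_zero]
    have h2 : (fun x => φ x • (0 : Lp (Cn n) 2 (vol Ω)) x i) =ᵐ[vol Ω] fun _ => 0 := by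
      filter_upwards [Lp.coeFn_zero (Cn n) 2 (vol Ω)] with x hx
      rw [hx, Pi.zero_apply, PiLp.zero_apply, smul_zero]
    exact (integral_congr_ae h1).trans
      (by rw [show (∫ x in Ω, φ x • (0 : L2Pair Ω).snd x i) = 0 from
            (integral_congr_ae h2).trans (by simp)]; simp)
  add_mem' := by
    intro a b ha hb φ hφ hs hsub i
    have hd := continuous_partialDeriv hφ i
    have hds := hasCompactSupport_partialDeriv hs i
    have h1 : (fun x => partialDeriv φ i x • (a + b).fst x) =ᵐ[vol Ω]
        fun x => partialDeriv φ i x • a.fst x + partialDeriv φ i x • b.fst x := by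
      filter_upwards [Lp.coeFn_add a.fst b.fst] with x hx
      rw [WithLp.add_fst, hx, Pi.add_apply, smul_add]
    have h2 : (fun x => φ x • (a + b).snd x i) =ᵐ[vol Ω]
        fun x => φ x • a.snd x i + φ x • b.snd x i := by
      filter_upwards [Lp.coeFn_add a.snd b.snd] with x hx
      rw [WithLp.add_snd, hx, Pi.add_apply, PiLp.add_apply, smul_add]
    rw [integral_congr_ae h1, integral_congr_ae h2,
      integral_add (integrable_smul_of_test hd hds (Lp.memLp _))
        (integrable_smul_of_test hd hds (Lp.memLp _)),
      integral_add (integrable_smul_of_test hφ.continuous hs (memLp_coord _ i))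
        (integrable_smul_of_test hφ.continuous hs (memLp_coord _ i)),
      ha φ hφ hs hsub i, hb φ hφ hs hsub i]
    ring
  smul_mem' := by
    intro c a ha φ hφ hs hsub i
    have h1 : (fun x => partialDeriv φ i x • (c • a).fst x) =ᵐ[vol Ω]
        fun x => c • (partialDeriv φ i x • a.fst x) := by
      filter_upwards [Lp.coeFn_smul c a.fst] with x hx
      rw [WithLp.smul_fst, hx, Pi.smul_apply, smul_comm]
    have h2 : (fun x => φ x • (c • a).snd x i) =ᵐ[vol Ω]
        fun x => c • (φ x • a.snd x i) := by
      filter_upwards [Lp.coeFn_smul c a.snd] with x hx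
      rw [WithLp.smul_snd, hx, Pi.smul_apply, PiLp.smul_apply, smul_comm]
    rw [integral_congr_ae h1, integral_congr_ae h2, integral_smul, integral_smul,
      ha φ hφ hs hsub i, smul_neg]

/-- The underlying `L²` function of `u ∈ H¹(Ω)`. -/
def fn {n : ℕ} {Ω : Set (Rn n)} (u : H1 Ω) : Lp ℂ 2 (vol Ω) := (u : L2Pair Ω).fst

/-- The weak gradient of `u ∈ H¹(Ω)`. -/
def grad {n : ℕ} {Ω : Set (Rn n)} (u : H1 Ω) : Lp (Cn n) 2 (vol Ω) := (u : L2Pair Ω).snd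

/-- `t` is the trace of `u ∈ H¹(Ω)` on `∂Ω`: there are smooth functions `φ k` on `ℝⁿ` with
`φ k → u` in `H¹(Ω)` and `φ k → t` in `L²(∂Ω)`. -/
def HasTrace {n : ℕ} {Ω : Set (Rn n)} (u : H1 Ω) (t : Lp ℂ 2 (surf Ω)) : Prop :=
  ∃ φ : ℕ → Rn n → ℂ, (∀ k, ContDiff ℝ (⊤ : ℕ∞) (φ k)) ∧
    Tendsto (fun k => eLpNorm (fun x => φ k x - fn u x) 2 (vol Ω)) atTop (𝓝 0) ∧
    Tendsto (fun k => eLpNorm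
      (fun x => (WithLp.toLp 2 fun i => partialDeriv (φ k) i x : Cn n) - grad u x) 2 (vol Ω))
      atTop (𝓝 0) ∧
    Tendsto (fun k => eLpNorm (fun x => φ k x - t x) 2 (surf Ω)) atTop (𝓝 0)

open scoped Classical in
/-- The trace operator `H¹(Ω) → L²(∂Ω)`. (On a bounded Lipschitz domain every `u ∈ H¹(Ω)` has
exactly one trace; the value `0` for a function without a trace is never used there.) -/
def trace {n : ℕ} {Ω : Set (Rn n)} (u : H1 Ω) : Lp ℂ 2 (surf Ω) :=
  if h : ∃ t, HasTrace u t then h.choose else 0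

/-- Extended electrodes: nonempty, relatively open, connected, mutually disjoint subsets of
`∂Ω`. -/
structure IsExtendedElectrodes {n M : ℕ} (Ω : Set (Rn n)) (E : Fin M → Set (Rn n)) : Prop where
  relOpen : ∀ m, ∃ O : Set (Rn n), IsOpen O ∧ E m = O ∩ frontier Ω
  isConnected : ∀ m, IsConnected (E m)
  disjoint : Pairwise fun m l => Disjoint (E m) (E l)

/-- The admissible domain admittivities `𝒮`: those `σ ∈ L^∞(Ω)` with `ess inf Re σ > 0`. -/
def AdmS {n : ℕ} (Ω : Set (Rn n)) : Set (Lp ℂ ∞ (vol Ω)) :=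
  {σ | ∃ c : ℝ, 0 < c ∧ ∀ᵐ x ∂(vol Ω), c ≤ (σ x).re}

/-- `L^∞(E)`, as the set of functions in `L^∞(∂Ω)` that vanish almost everywhere outside the
extended electrodes (zero continuation). -/
def LinfE {n M : ℕ} (Ω : Set (Rn n)) (E : Fin M → Set (Rn n)) : Set (Lp ℂ ∞ (surf Ω)) :=
  {ζ | ∀ᵐ x ∂(surf Ω), x ∉ ⋃ m, E m → ζ x = 0}

/-- The subspace `ℂ^M_⋄` of vectors whose components sum to zero. -/
def diamond (M : ℕ) : Submodule ℂ (Cn M) where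
  carrier := {J | ∑ m, J m = 0}
  zero_mem' := by simp
  add_mem' := by
    intro a b ha hb
    have ha' : ∑ m, a m = 0 := ha
    have hb' : ∑ m, b m = 0 := hb
    simp [Finset.sum_add_distrib, ha', hb']
  smul_mem' := by
    intro c a ha
    have ha' : ∑ m, a m = 0 := ha
    simp [← Finset.mul_sum, ha']

/-- The piecewise constant function `∑ₘ Vₘ χₘ` identified with `V ∈ ℂ^M`. -/
def pwConst {n M : ℕ} (E : Fin M → Set (Rn n)) (V : Cn M) (x : Rn n) : ℂ :=
  ∑ m, (E m).indicator (fun _ => V m) x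

/-- `H¹(Ω) ⊕ ℂ^M` with the norm `(‖v‖²_{H¹} + ‖V‖₂²)^{1/2}`. -/
abbrev HSum {n : ℕ} (Ω : Set (Rn n)) (M : ℕ) : Type := WithLp 2 (H1 Ω × Cn M)

/-- The multiples `(c, c𝟏)`, `c ∈ ℂ`, of the constant pair in `H¹(Ω) ⊕ ℂ^M`. -/
def constPairs {n : ℕ} (Ω : Set (Rn n)) (M : ℕ) : Submodule ℂ (HSum Ω M) where
  carrier := {p | ∃ c : ℂ, (∀ᵐ x ∂(vol Ω), fn p.fst x = c) ∧ grad p.fst = 0 ∧ ∀ m, p.snd m = c}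
  zero_mem' := ⟨0, by
    refine ⟨?_, rfl, fun m => rfl⟩
    filter_upwards [Lp.coeFn_zero ℂ 2 (vol Ω)] with x hx using hx⟩
  add_mem' := by
    rintro a b ⟨c, h1, h2, h3⟩ ⟨d, k1, k2, k3⟩
    refine ⟨c + d, ?_, ?_, fun m => ?_⟩
    · filter_upwards [h1, k1, Lp.coeFn_add (fn a.fst) (fn b.fst)] with x hx kx hs
      exact hs.trans (by rw [Pi.add_apply, hx, kx])
    · change grad a.fst + grad b.fst = 0
      rw [h2, k2, add_zero]
    · rw [WithLp.add_snd, PiLp.add_apply, h3, k3]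
  smul_mem' := by
    rintro r a ⟨c, h1, h2, h3⟩
    refine ⟨r * c, ?_, ?_, fun m => ?_⟩
    · filter_upwards [h1, Lp.coeFn_smul r (fn a.fst)] with x hx hs
      exact hs.trans (by rw [Pi.smul_apply, hx, smul_eq_mul])
    · change r • grad a.fst = 0
      rw [h2, smul_zero]
    · rw [WithLp.smul_snd, PiLp.smul_apply, h3, smul_eq_mul]

/-- The quotient space `ℋ¹ = (H¹(Ω) ⊕ ℂ^M) / ℂ(1, 𝟏)`, with its quotient norm
`inf_c (‖v - c‖²_{H¹} + ‖V - c𝟏‖₂²)^{1/2}`. -/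
abbrev HQuot {n : ℕ} (Ω : Set (Rn n)) (M : ℕ) : Type := HSum Ω M ⧸ constPairs Ω M

/-- The class in `ℋ¹` of a pair in `H¹(Ω) ⊕ ℂ^M`. -/
def HQuot.cls {n M : ℕ} {Ω : Set (Rn n)} (p : HSum Ω M) : HQuot Ω M := (constPairs Ω M).mkQ p

/-- The quotient norm `‖V‖_{ℂ^M/ℂ} = inf_c ‖V - c𝟏‖₂`. -/
def quotNorm {M : ℕ} (V : Cn M) : ℝ := ⨅ c : ℂ, ‖V - c • (WithLp.toLp 2 fun _ => 1 : Cn M)‖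

/-- The sesquilinear form `B_{σ,ζ}((w,W),(v,V))`, evaluated on representatives:
`∫_Ω σ ∇w·∇v̄ dx + ∫_{∂Ω} ζ (W - w)(V̄ - v̄) dS`. -/
def form {n M : ℕ} {Ω : Set (Rn n)} (E : Fin M → Set (Rn n)) (σ : Lp ℂ ∞ (vol Ω))
    (ζ : Lp ℂ ∞ (surf Ω)) (p q : HSum Ω M) : ℂ :=
  (∫ x, σ x * ∑ i, grad p.fst x i * starRingEnd ℂ (grad q.fst x i) ∂(vol Ω)) +
    ∫ x, ζ x * (pwConst E p.snd x - trace p.fst x) *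
      starRingEnd ℂ (pwConst E q.snd x - trace q.fst x) ∂(surf Ω)

/-- The extended set `𝒵'` of boundary admittivities: those `ζ ∈ L^∞(E)` for which, for every
`σ ∈ 𝒮`, the form `B_{σ,ζ}` is coercive on `ℋ¹`. -/
def AdmZ {n M : ℕ} (Ω : Set (Rn n)) (E : Fin M → Set (Rn n)) : Set (Lp ℂ ∞ (surf Ω)) :=
  {ζ | ζ ∈ LinfE Ω E ∧ ∀ σ ∈ AdmS Ω, ∃ c : ℝ, 0 < c ∧
    ∀ p : HSum Ω M, c * ‖HQuot.cls p‖ ^ 2 ≤ (form E σ ζ p p).re}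

/-- The class `s ∈ ℋ¹` solves the forward problem with current pattern `I` in the weak sense:
`B_{σ,ζ}((u,U),(v,V)) = I · V̄` for all `(v,V)`, for the representatives `(u,U)` of `s`. -/
def IsSolution {n M : ℕ} {Ω : Set (Rn n)} (E : Fin M → Set (Rn n)) (σ : Lp ℂ ∞ (vol Ω))
    (ζ : Lp ℂ ∞ (surf Ω)) (I : diamond M) (s : HQuot Ω M) : Prop :=
  ∀ p : HSum Ω M, HQuot.cls p = s → ∀ q : HSum Ω M,
    form E σ ζ p q = ∑ m, (I : Cn M) m * starRingEnd ℂ (q.snd m)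

/-- `U ∈ ℂ^M_⋄` is the zero-mean electrode potential of a weak solution for `(σ, ζ, I)`. -/
def IsElectrodePotential {n M : ℕ} {Ω : Set (Rn n)} (E : Fin M → Set (Rn n))
    (σ : Lp ℂ ∞ (vol Ω)) (ζ : Lp ℂ ∞ (surf Ω)) (I U : diamond M) : Prop :=
  ∃ u : H1 Ω, IsSolution E σ ζ I (HQuot.cls (WithLp.toLp 2 (u, (U : Cn M))))

open scoped Classical in
/-- The measurement map `(σ, ζ, I) ↦ U(σ, ζ, I)`: the electrode component, with the ground level
of potential chosen so that it has zero mean, of the weak solution. (The value is `0` if there is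
no solution.) -/
def measurementMap {n M : ℕ} {Ω : Set (Rn n)} (E : Fin M → Set (Rn n)) (σ : Lp ℂ ∞ (vol Ω))
    (ζ : Lp ℂ ∞ (surf Ω)) (I : diamond M) : diamond M :=
  if h : ∃ U : diamond M, IsElectrodePotential E σ ζ I U then h.choose else 0

end EIT

end

open EIT

/-!
The forms `B_{σ,ζ}` live on the Hilbert space `ℋ¹`, realized as the orthogonal complement `HPerp`
of the constant pairs in `H¹(Ω) ⊕ ℂ^M`. On it `B_{σ,ζ}` is represented by a bounded operator
`A σ ζ`, which depends additively on `(σ, ζ)` and satisfies `‖A ω η‖ ≤ C max (‖ω‖, ‖η‖)`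
(`EIT.exists_forwardOperator`); the functional `(v, V) ↦ I · V̄` is represented by a vector of
norm `‖I‖`. A weak solution is therefore a solution of `A σ ζ x = current I`. For `σ ∈ 𝒮` and
`ζ ∈ 𝒵'` the operator is coercive, hence bijective (`EIT.bijective_of_coercive`), and a
perturbation of norm at most half the coercivity constant stays coercive; comparing the two
equations gives the estimate for the difference of the solutions
(`EIT.norm_sub_le_of_coercive`). The estimate passes to the electrode potentials because zero-mean
vectors are orthogonal to `𝟏` (`EIT.norm_le_quotNorm`), and continuity of the measurement map
follows from it.

What makes the boundary integral in `B_{σ,ζ}` a bounded form is the trace theorem on a bounded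
Lipschitz domain: every `u ∈ H¹(Ω)` has exactly one trace in `L²(∂Ω)`, the trace is linear and
bounded in `u`, and it is `c` for the constant function `c`. It has two parts.

* The trace inequality `EIT.trace_inequality` for smooth functions: near a boundary point `∂Ω` is
  a graph, a Lipschitz image of a hyperplane, so that its surface measure is dominated by Lebesgue
  measure there; on each line transversal to the boundary, the value at the boundary is bounded by
  the integrals of the function and of its derivative over an interval inside `Ω`; a compactness
  argument patches the pieces together.
* Density of smooth functions of `ℝⁿ` in `H¹(Ω)`
  (`EIT.IsBoundedLipschitzDomain.exists_smooth_approx`): a partition of unity reduces to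
  pieces of small support, and these are mollified with a kernel centred slightly off the origin,
  in the direction pointing into `Ω`. For points of `Ω` such a kernel only sees values from inside
  `Ω`, so that mollification commutes with the weak gradient up to the boundary.

Consequently the closure of the set of triples `((φ, ∇φ), φ|∂Ω)`, `φ` smooth, is the graph of a
bounded operator on `H¹(Ω)` (`EIT.exists_trace_eq_continuousLinearMap`).
-/

namespace EIT

/-! ### Coercive operators on Hilbert spaces -/

/-- The Lax–Milgram lemma for operators: a coercive operator on a complex Hilbert space is
bijective. -/
theorem bijective_of_coercive {H : Type*} [NormedAddCommGroup H] [InnerProductSpace ℂ H]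
    [CompleteSpace H] (A : H →L[ℂ] H) {c : ℝ} (hc : 0 < c)
    (hA : ∀ x, c * ‖x‖ ^ 2 ≤ (inner ℂ x (A x)).re) :
    (∀ x, c * ‖x‖ ≤ ‖A x‖) ∧ Function.Bijective A := by
  have hb : ∀ x, c * ‖x‖ ≤ ‖A x‖ := fun x => by
    rcases (norm_nonneg x).eq_or_lt with h | h
    · rw [← h, mul_zero]; exact norm_nonneg _
    · have h1 := (hA x).trans ((Complex.re_le_norm _).trans (norm_inner_le_norm x (A x)))
      nlinarith
  refine ⟨hb, ?_⟩
  have hanti : AntilipschitzWith (c⁻¹).toNNReal A := by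
    refine A.antilipschitz_of_bound fun x => ?_
    rw [Real.coe_toNNReal _ (inv_pos.2 hc).le, ← div_eq_inv_mul, le_div_iff₀ hc, mul_comm]
    exact hb x
  refine ⟨hanti.injective, ?_⟩
  have hcl : IsClosed (A.range : Set H) := hanti.isClosed_range A.uniformContinuous
  have := hcl.completeSpace_coe
  have htop : A.range = ⊤ := by
    rw [← A.range.orthogonal_orthogonal, Submodule.eq_top_iff']
    intro v w hw
    obtain rfl : w = 0 := by
      have h0 : inner ℂ (A w) w = 0 := hw _ ⟨w, rfl⟩
      have h1 := hA w
      rw [← inner_conj_symm, h0] at h1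
      simp only [map_zero, Complex.zero_re] at h1
      have : ‖w‖ ^ 2 ≤ 0 := by nlinarith
      exact norm_eq_zero.1 (pow_eq_zero_iff two_ne_zero |>.1 (le_antisymm this (sq_nonneg _)))
    exact inner_zero_left _
  exact LinearMap.range_eq_top.1 htop

/-! ### The trace inequality for smooth functions -/

/-- The surface measure of a graph over the hyperplane `νᗮ` is dominated by the image of the
Lebesgue measure of `νᗮ` under the graph map. -/
theorem restrict_graph_le {n : ℕ} (hn : 1 ≤ n) {ν : Rn n} (hν : ‖ν‖ = 1) {K : ℝ≥0}
    {g : Rn n → ℝ} (hg : LipschitzWith K g) (hinv : ∀ (x : Rn n) (t : ℝ), g (x + t • ν) = g x)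
    {A : Set (Rn n)} (hA : ∀ x ∈ A, g x = inner ℝ ν x) :
    ∃ C : ℝ≥0, (μHE[n - 1] : Measure (Rn n)).restrict A ≤
      C • (volume : Measure (ℝ ∙ ν)ᗮ).map (fun y : (ℝ ∙ ν)ᗮ => (y : Rn n) + g y • ν) := by
  set G : (ℝ ∙ ν)ᗮ → Rn n := fun y => (y : Rn n) + g y • ν with hG
  have hGlip : LipschitzWith (1 + K) G := by
    refine LipschitzWith.add (LipschitzWith.subtype_val _) ?_
    refine LipschitzWith.of_dist_le_mul fun x y => ?_
    rw [dist_eq_norm, ← sub_smul, norm_smul, hν, mul_one, ← dist_eq_norm]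
    exact hg.dist_le_mul _ _
  refine ⟨(1 + K) ^ (n - 1), Measure.le_iff.2 fun S hS => ?_⟩
  rw [Measure.restrict_apply hS, Measure.smul_apply, Measure.map_apply hGlip.continuous.measurable hS]
  have hsub : S ∩ A ⊆ G '' (G ⁻¹' S) := by
    rintro x ⟨hxS, hxA⟩
    have hx : G ((ℝ ∙ ν)ᗮ.orthogonalProjectionOnto x) = x := by
      have h1 : (((ℝ ∙ ν)ᗮ.orthogonalProjectionOnto x : (ℝ ∙ ν)ᗮ) : Rn n)
          = x - (inner ℝ ν x : ℝ) • ν := by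
        rw [Submodule.coe_orthogonalProjectionOnto_apply, Submodule.starProjection_orthogonal]
        simp [Submodule.starProjection_unit_singleton ℝ hν]
      have h2 : g (x - (inner ℝ ν x : ℝ) • ν) = g x := by
        rw [sub_eq_add_neg, ← neg_smul]; exact hinv _ _
      simp only [hG, h1, h2, hA x hxA, sub_add_cancel]
    exact ⟨_, by rwa [mem_preimage, hx], hx⟩
  have hfin : Module.finrank ℝ (ℝ ∙ ν)ᗮ = n - 1 := by
    have : Fact (Module.finrank ℝ (Rn n) = (n - 1) + 1) := ⟨by simp; omega⟩
    exact Submodule.finrank_orthogonal_span_singleton (by rintro rfl; simp at hν)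
  refine (measure_mono hsub).trans ?_
  rw [← InnerProductSpace.euclideanHausdorffMeasure_eq_volume, hfin]
  simp only [Measure.euclideanHausdorffMeasure_def, Measure.smul_apply]
  have h := hGlip.hausdorffMeasure_image_le (d := ((n - 1 : ℕ) : ℝ)) (Nat.cast_nonneg _) (G ⁻¹' S)
  rw [smul_comm]
  refine smul_le_smul_of_nonneg_left (h.trans_eq ?_) zero_le
  rw [ENNReal.rpow_natCast, ENNReal.smul_def, smul_eq_mul]
  simp

/-- Fubini's theorem for the decomposition of space into lines parallel to a unit vector `ν`. -/
theorem lintegral_orthogonal_lintegral_line {n : ℕ} {ν : Rn n} (hν : ‖ν‖ = 1) {F : Rn n → ℝ≥0∞}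
    (hF : Measurable F) :
    ∫⁻ y : (ℝ ∙ ν)ᗮ, ∫⁻ t : ℝ, F ((y : Rn n) + t • ν) = ∫⁻ x, F x := by
  have e1 := (Submodule.measurePreserving_measurableEquivProd (ℝ ∙ ν) (0 : Rn n))
  rw [InnerProductSpace.euclideanHausdorffMeasure_eq_volume] at e1
  have e2 := (LinearIsometryEquiv.toSpanUnitSingleton (𝕜 := ℝ) ν hν).measurePreserving
  have e3 := e1.symm.lintegral_comp hF
  rw [← e3]
  rw [show (volume : Measure ((ℝ ∙ ν) × (ℝ ∙ ν)ᗮ)) = (volume.prod volume) from rfl]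
  rw [lintegral_prod_symm']
  · refine lintegral_congr fun y => ?_
    rw [← e2.lintegral_comp]
    · refine lintegral_congr fun t => ?_
      congr 1
      simp [add_comm]
    · exact hF.comp ((MeasurableEquiv.measurable _).comp (measurable_id.prodMk measurable_const))
  · exact hF.comp (MeasurableEquiv.measurable _)

/-- A surface integral over a graph of integrals along vertical lines is dominated by a volume
integral. -/
theorem lintegral_graph_lintegral_line_le {n : ℕ} (hn : 1 ≤ n) {ν : Rn n} (hν : ‖ν‖ = 1) {K : ℝ≥0}
    {g : Rn n → ℝ} (hg : LipschitzWith K g) (hinv : ∀ (x : Rn n) (t : ℝ), g (x + t • ν) = g x)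
    {A : Set (Rn n)} (hA : ∀ x ∈ A, g x = inner ℝ ν x) :
    ∃ C : ℝ≥0, ∀ F : Rn n → ℝ≥0∞, Measurable F →
      ∫⁻ x in A, (∫⁻ t : ℝ, F (x + t • ν)) ∂μHE[n - 1] ≤ C * ∫⁻ x, F x := by
  obtain ⟨C, hC⟩ := restrict_graph_le hn hν hg hinv hA
  refine ⟨C, fun F hF => (lintegral_mono' hC le_rfl).trans_eq ?_⟩
  have hm : Measurable fun x : Rn n => ∫⁻ t : ℝ, F (x + t • ν) := by
    refine Measurable.lintegral_prod_right' (f := fun p : Rn n × ℝ => F (p.1 + p.2 • ν)) ?_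
    exact hF.comp (by fun_prop)
  have hgc := hg.continuous
  rw [lintegral_smul_measure, lintegral_map hm (by fun_prop),
    ← lintegral_orthogonal_lintegral_line hν hF, ENNReal.smul_def, smul_eq_mul]
  congr 1
  refine lintegral_congr fun y => ?_
  rw [← lintegral_add_left_eq_self (fun t => F ((y : Rn n) + t • ν)) (g y)]
  simp only [add_smul, add_assoc]

/-- The one-dimensional trace inequality on `[0, r]`. -/
theorem ofReal_norm_sq_le_lintegral {f f' : ℝ → ℂ} (hf : ∀ t, HasDerivAt f (f' t) t)
    (hc : Continuous f') {r : ℝ} (hr : 0 < r) :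
    ENNReal.ofReal (‖f 0‖ ^ 2) ≤
      ∫⁻ t in Ioc 0 r, ENNReal.ofReal ((1 / r + 1) * ‖f t‖ ^ 2 + ‖f' t‖ ^ 2) := by
  have hfc : Continuous f := continuous_iff_continuousAt.2 fun t => (hf t).continuousAt
  -- the fundamental theorem of calculus for `t ↦ (1 - t / r) |f t|²`
  have hd : ∀ t ∈ uIcc 0 r, HasDerivAt (fun t => (t / r - 1) * ‖f t‖ ^ 2)
      (1 / r * ‖f t‖ ^ 2 + (t / r - 1) * (2 * inner ℝ (f t) (f' t))) t := fun t _ =>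
    (((hasDerivAt_id t).div_const r).sub_const 1).mul (hf t).norm_sq
  have hcont : Continuous fun t =>
      1 / r * ‖f t‖ ^ 2 + (t / r - 1) * (2 * inner ℝ (f t) (f' t)) := by fun_prop
  have h := intervalIntegral.integral_eq_sub_of_hasDerivAt hd (hcont.intervalIntegrable _ _)
  have hcont2 : Continuous fun t => (1 / r + 1) * ‖f t‖ ^ 2 + ‖f' t‖ ^ 2 := by fun_prop
  have hle : ‖f 0‖ ^ 2 ≤ ∫ t in (0 : ℝ)..r, ((1 / r + 1) * ‖f t‖ ^ 2 + ‖f' t‖ ^ 2) := by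
    have : ‖f 0‖ ^ 2 = ∫ t in (0 : ℝ)..r,
        (1 / r * ‖f t‖ ^ 2 + (t / r - 1) * (2 * inner ℝ (f t) (f' t))) := by
      rw [h, div_self hr.ne']; ring
    rw [this]
    refine intervalIntegral.integral_mono_on hr.le (hcont.intervalIntegrable _ _)
      (hcont2.intervalIntegrable _ _) fun t ht => ?_
    have h1 : t / r ≤ 1 := (div_le_one hr).2 ht.2
    have h0 : 0 ≤ t / r := div_nonneg ht.1 hr.le
    have h2 := abs_le.1 (abs_real_inner_le_norm (f t) (f' t))
    have h3 : 2 * (‖f t‖ * ‖f' t‖) ≤ ‖f t‖ ^ 2 + ‖f' t‖ ^ 2 := by nlinarith [sq_nonneg (‖f t‖ - ‖f' t‖)]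
    have h4 : (t / r - 1) * (2 * inner ℝ (f t) (f' t)) ≤ (1 - t / r) * (2 * (‖f t‖ * ‖f' t‖)) := by
      nlinarith
    have h5 : (1 - t / r) * (2 * (‖f t‖ * ‖f' t‖)) ≤ 1 * (2 * (‖f t‖ * ‖f' t‖)) :=
      mul_le_mul_of_nonneg_right (by linarith) (by positivity)
    linarith
  refine (ENNReal.ofReal_le_ofReal hle).trans_eq ?_
  rw [intervalIntegral.integral_of_le hr.le, ofReal_integral_eq_lintegral_ofReal]
  · exact (hcont2.integrableOn_Icc).mono_set Ioc_subset_Icc_self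
  · exact Eventually.of_forall fun t => by positivity

/-- The classical gradient of a smooth function, as a vector of `ℂⁿ`. -/
noncomputable def gradVec {n : ℕ} (φ : Rn n → ℂ) (x : Rn n) : Cn n :=
  WithLp.toLp 2 fun i => partialDeriv φ i x

theorem norm_fderiv_apply_le_norm_gradVec {n : ℕ} (φ : Rn n → ℂ) (x ν : Rn n) (hν : ‖ν‖ = 1) :
    ‖fderiv ℝ φ x ν‖ ≤ ‖gradVec φ x‖ := by
  have h1 : fderiv ℝ φ x ν = inner ℂ (WithLp.toLp 2 fun i => (ν i : ℂ) : Cn n) (gradVec φ x) := by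
    conv_lhs => rw [← (EuclideanSpace.basisFun (Fin n) ℝ).sum_repr ν]
    simp [PiLp.inner_apply, gradVec, partialDeriv, mul_comm]
  have h2 : ‖(WithLp.toLp 2 fun i => (ν i : ℂ) : Cn n)‖ = 1 := by
    rw [← hν, EuclideanSpace.norm_eq, EuclideanSpace.norm_eq]; simp
  rw [h1]
  simpa [h2] using norm_inner_le_norm (𝕜 := ℂ) (WithLp.toLp 2 fun i => (ν i : ℂ) : Cn n) (gradVec φ x)

theorem continuous_gradVec {n : ℕ} {φ : Rn n → ℂ} (hφ : ContDiff ℝ (⊤ : ℕ∞) φ) :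
    Continuous (gradVec φ) :=
  (PiLp.continuous_toLp 2 _).comp (continuous_pi fun _ =>
    (hφ.continuous_fderiv (by simp)).clm_apply continuous_const)

/-- Near each boundary point, the boundary of a Lipschitz domain is contained in a Lipschitz graph,
and short segments pointing in the graph direction enter the domain. -/
theorem IsBoundedLipschitzDomain.exists_local_graph {n : ℕ} {Ω : Set (Rn n)}
    (hΩ : IsBoundedLipschitzDomain Ω) {x₀ : Rn n} (hx₀ : x₀ ∈ frontier Ω) :
    ∃ (ν : Rn n) (K : ℝ≥0) (g : Rn n → ℝ) (r : ℝ), 0 < r ∧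
      ‖ν‖ = 1 ∧ LipschitzWith K g ∧ (∀ (x : Rn n) (t : ℝ), g (x + t • ν) = g x) ∧
      (∀ x ∈ Metric.ball x₀ (2 * r), (x ∈ Ω ↔ g x < inner ℝ ν x)) ∧
      (∀ x ∈ frontier Ω ∩ Metric.ball x₀ r, g x = inner ℝ ν x) ∧
      ∀ x ∈ frontier Ω ∩ Metric.ball x₀ r, ∀ t ∈ Ioc 0 r, x + t • ν ∈ Ω := by
  obtain ⟨ν, K, g, hν, hg, hinv, hev⟩ := hΩ.lipschitz_boundary x₀ hx₀
  obtain ⟨ε, hε, hball⟩ := Metric.eventually_nhds_iff_ball.1 hev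
  have hball' : ∀ x ∈ Metric.ball x₀ (2 * (ε / 2)), (x ∈ Ω ↔ g x < inner ℝ ν x) := fun x hx =>
    hball x (by rwa [mul_div_cancel₀ _ two_ne_zero] at hx)
  have hgraph : ∀ x ∈ frontier Ω ∩ Metric.ball x₀ (ε / 2), g x = inner ℝ ν x := by
    rintro x ⟨hxf, hxb⟩
    have hxb' : x ∈ Metric.ball x₀ ε := Metric.ball_subset_ball (by linarith) hxb
    have hnot : x ∉ Ω := fun h => by
      rw [hΩ.isOpen.frontier_eq] at hxf; exact hxf.2 h
    refine le_antisymm (not_lt.1 fun hlt => ?_) (not_lt.1 fun hlt => hnot ((hball x hxb').2 hlt))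
    have hgc := hg.continuous
    have hU : {y | inner ℝ ν y < g y} ∩ Metric.ball x₀ ε ∈ 𝓝 x :=
      ((isOpen_lt (by fun_prop) hgc).inter Metric.isOpen_ball).mem_nhds ⟨hlt, hxb'⟩
    obtain ⟨y, ⟨hy1, hy2⟩, hy3⟩ := mem_closure_iff_nhds.1 (frontier_subset_closure hxf) _ hU
    exact absurd ((hball y hy2).1 hy3) (not_lt.2 (le_of_lt hy1))
  refine ⟨ν, K, g, ε / 2, half_pos hε, hν, hg, hinv, hball', hgraph, fun x hx t ht => ?_⟩
  have hb : x + t • ν ∈ Metric.ball x₀ ε := by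
    rw [Metric.mem_ball, dist_eq_norm]
    have h1 : ‖x - x₀‖ < ε / 2 := by simpa [dist_eq_norm] using hx.2
    have h2 : ‖t • ν‖ ≤ ε / 2 := by
      rw [norm_smul, hν, mul_one, Real.norm_of_nonneg ht.1.le]; exact ht.2
    calc ‖x + t • ν - x₀‖ = ‖(x - x₀) + t • ν‖ := by congr 1; abel
      _ ≤ ‖x - x₀‖ + ‖t • ν‖ := norm_add_le _ _
      _ < ε := by linarith
  rw [hball _ hb, hinv, hgraph x hx, inner_add_right, inner_smul_right,
    real_inner_self_eq_norm_sq, hν]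
  nlinarith [ht.1]

/-- The trace inequality on a piece `A` of a graph such that `Ω` contains the segments
`x + (0, r] ν`: integrate the one-dimensional inequality on these segments over `A`. -/
theorem trace_inequality_aux {n : ℕ} (hn : 1 ≤ n) {Ω : Set (Rn n)} (hO : IsOpen Ω)
    {ν : Rn n} {K : ℝ≥0} {g : Rn n → ℝ} {r : ℝ} (hr : 0 < r) (hν : ‖ν‖ = 1)
    (hg : LipschitzWith K g) (hinv : ∀ (x : Rn n) (t : ℝ), g (x + t • ν) = g x)
    {A : Set (Rn n)} (hAm : MeasurableSet A) (hA : ∀ x ∈ A, g x = inner ℝ ν x)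
    (hin : ∀ x ∈ A, ∀ t ∈ Ioc 0 r, x + t • ν ∈ Ω) :
    ∃ C : ℝ≥0, ∀ φ : Rn n → ℂ, ContDiff ℝ (⊤ : ℕ∞) φ →
      ∫⁻ x in A, ‖φ x‖ₑ ^ 2 ∂μHE[n - 1] ≤
        C * ((∫⁻ x in Ω, ‖φ x‖ₑ ^ 2) + ∫⁻ x in Ω, ‖gradVec φ x‖ₑ ^ 2) := by
  obtain ⟨C, hC⟩ := lintegral_graph_lintegral_line_le hn hν hg hinv hA
  refine ⟨C * Real.toNNReal (1 / r + 1), fun φ hφ => ?_⟩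
  have hgc := continuous_gradVec hφ
  have hφc := hφ.continuous
  set H : Rn n → ℝ≥0∞ := fun x => ENNReal.ofReal ((1 / r + 1) * ‖φ x‖ ^ 2 + ‖gradVec φ x‖ ^ 2) with hH
  have hHm : Measurable H := (by fun_prop : Continuous _).measurable.ennreal_ofReal
  have key : ∀ x ∈ A, ‖φ x‖ₑ ^ 2 ≤ ∫⁻ t : ℝ, Ω.indicator H (x + t • ν) := by
    intro x hx
    have hline : ∀ t : ℝ, HasDerivAt (fun t : ℝ => φ (x + t • ν)) (fderiv ℝ φ (x + t • ν) ν) t := by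
      intro t
      have h1 : HasDerivAt (fun t : ℝ => x + t • ν) ν t := by
        simpa using ((hasDerivAt_id t).smul_const ν).const_add x
      exact ((hφ.differentiable (by simp)) _).hasFDerivAt.comp_hasDerivAt t h1
    have hcd : Continuous fun t : ℝ => fderiv ℝ φ (x + t • ν) ν :=
      ((hφ.continuous_fderiv (by simp)).comp (by fun_prop)).clm_apply continuous_const
    have h := ofReal_norm_sq_le_lintegral hline hcd hr
    rw [zero_smul, add_zero] at h
    rw [← ofReal_norm, ← ENNReal.ofReal_pow (norm_nonneg _)]
    refine h.trans ?_
    rw [← lintegral_indicator measurableSet_Ioc]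
    refine lintegral_mono fun t => ?_
    by_cases ht : t ∈ Ioc 0 r
    · rw [indicator_of_mem ht, indicator_of_mem (hin x hx t ht)]
      refine ENNReal.ofReal_le_ofReal ?_
      have := norm_fderiv_apply_le_norm_gradVec φ (x + t • ν) ν hν
      gcongr
    · rw [indicator_of_notMem ht]; exact zero_le
  refine (setLIntegral_mono' hAm key).trans ((hC _ (hHm.indicator hO.measurableSet)).trans ?_)
  rw [lintegral_indicator hO.measurableSet, ← lintegral_add_left (by fun_prop), ENNReal.coe_mul,
    mul_assoc]
  gcongr
  rw [← lintegral_const_mul _ (by fun_prop)]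
  refine lintegral_mono fun x => ?_
  change ENNReal.ofReal _ ≤ ENNReal.ofReal _ * _
  rw [← ofReal_norm, ← ofReal_norm, ← ENNReal.ofReal_pow (norm_nonneg _),
    ← ENNReal.ofReal_pow (norm_nonneg _), ← ENNReal.ofReal_add (by positivity) (by positivity),
    ← ENNReal.ofReal_mul (by positivity)]
  refine ENNReal.ofReal_le_ofReal ?_
  have : 0 < 1 / r := by positivity
  nlinarith [sq_nonneg ‖gradVec φ x‖]

/-- The trace inequality for smooth functions on a bounded Lipschitz domain. -/
theorem trace_inequality {n : ℕ} (hn : 1 ≤ n) {Ω : Set (Rn n)} (hΩ : IsBoundedLipschitzDomain Ω) :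
    ∃ C : ℝ≥0, ∀ φ : Rn n → ℂ, ContDiff ℝ (⊤ : ℕ∞) φ →
      ∫⁻ x, ‖φ x‖ₑ ^ 2 ∂(surf Ω) ≤
        C * ((∫⁻ x in Ω, ‖φ x‖ₑ ^ 2) + ∫⁻ x in Ω, ‖gradVec φ x‖ₑ ^ 2) := by
  have hcomp : IsCompact (frontier Ω) :=
    Metric.isCompact_of_isClosed_isBounded isClosed_frontier
      (hΩ.isBounded.closure.subset frontier_subset_closure)
  suffices h : ∃ C : ℝ≥0, ∀ φ : Rn n → ℂ, ContDiff ℝ (⊤ : ℕ∞) φ →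
      ∫⁻ x in frontier Ω ∩ frontier Ω, ‖φ x‖ₑ ^ 2 ∂μHE[n - 1] ≤
        C * ((∫⁻ x in Ω, ‖φ x‖ₑ ^ 2) + ∫⁻ x in Ω, ‖gradVec φ x‖ₑ ^ 2) by simpa using h
  refine hcomp.induction_on (p := fun S => ∃ C : ℝ≥0, ∀ φ : Rn n → ℂ, ContDiff ℝ (⊤ : ℕ∞) φ →
      ∫⁻ x in frontier Ω ∩ S, ‖φ x‖ₑ ^ 2 ∂μHE[n - 1] ≤
        C * ((∫⁻ x in Ω, ‖φ x‖ₑ ^ 2) + ∫⁻ x in Ω, ‖gradVec φ x‖ₑ ^ 2)) ⟨0, by simp⟩ ?_ ?_ ?_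
  · rintro S T hST ⟨C, hC⟩
    exact ⟨C, fun φ hφ => (lintegral_mono_set (inter_subset_inter_right _ hST)).trans (hC φ hφ)⟩
  · rintro S T ⟨C, hC⟩ ⟨D, hD⟩
    refine ⟨C + D, fun φ hφ => ?_⟩
    rw [inter_union_distrib_left, ENNReal.coe_add, add_mul]
    exact (lintegral_union_le _ _ _).trans (add_le_add (hC φ hφ) (hD φ hφ))
  · intro x₀ hx₀
    obtain ⟨ν, K, g, r, hr, hν, hg, hinv, -, h1, h2⟩ := hΩ.exists_local_graph hx₀
    exact ⟨Metric.ball x₀ r, mem_nhdsWithin_of_mem_nhds (Metric.ball_mem_nhds _ hr),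
      trace_inequality_aux hn hΩ.isOpen hr hν hg hinv
        (isClosed_frontier.measurableSet.inter Metric.isOpen_ball.measurableSet) h1 h2⟩

/-! ### Mollification and translation in `L²` -/

theorem eLpNorm_two_sq {α E : Type*} [MeasurableSpace α] [NormedAddCommGroup E] (f : α → E)
    (μ : Measure α) : eLpNorm f 2 μ ^ 2 = ∫⁻ x, ‖f x‖ₑ ^ 2 ∂μ := by
  have h := eLpNorm_nnreal_pow_eq_lintegral (μ := μ) (f := f) (p := 2) two_ne_zero
  simpa using h

/-- Translations act continuously on `L²`. -/
theorem exists_translation_le {n : ℕ} {E : Type*} [NormedAddCommGroup E] {f : Rn n → E}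
    (hf : MemLp f 2 volume) {ε : ℝ≥0∞} (hε : ε ≠ 0) :
    ∃ δ : ℝ, 0 < δ ∧ ∀ z : Rn n, ‖z‖ < δ → eLpNorm (fun x => f (x + z) - f x) 2 volume ≤ ε := by
  let T : C(Rn n, C(Rn n, Rn n)) := ContinuousMap.curry ⟨fun p => p.2 + p.1, by fun_prop⟩
  have hT : ∀ z, MeasurePreserving (T z) (volume : Measure (Rn n)) volume := fun z =>
    measurePreserving_add_right volume z
  have h := (continuous_const (y := hf.toLp f)).compMeasurePreservingLp T.continuous hT (by simp)
  have h0 := h.tendsto 0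
  rw [Metric.tendsto_nhds_nhds] at h0
  obtain ⟨e, he, hee⟩ : ∃ e : ℝ, 0 < e ∧ ENNReal.ofReal e ≤ ε := by
    rcases eq_or_ne ε ⊤ with rfl | ht
    · exact ⟨1, one_pos, le_top⟩
    · exact ⟨ε.toReal, ENNReal.toReal_pos hε ht, (ENNReal.ofReal_toReal ht).le⟩
  obtain ⟨δ, hδ, hd⟩ := h0 e he
  refine ⟨δ, hδ, fun z hz => ?_⟩
  have h1 := hd (x := z) (by simpa using hz)
  refine le_trans ?_ hee
  rw [dist_edist, Lp.edist_def] at h1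
  have h2 : eLpNorm (fun x => f (x + z) - f x) 2 volume = eLpNorm
      (⇑(Lp.compMeasurePreserving (T z) (hT z) (hf.toLp f)) -
        ⇑(Lp.compMeasurePreserving (T 0) (hT 0) (hf.toLp f))) 2 volume := by
    refine eLpNorm_congr_ae ?_
    filter_upwards [Lp.coeFn_compMeasurePreserving (hf.toLp f) (hT z),
      Lp.coeFn_compMeasurePreserving (hf.toLp f) (hT 0),
      (hT z).quasiMeasurePreserving.ae_eq_comp hf.coeFn_toLp,
      (hT 0).quasiMeasurePreserving.ae_eq_comp hf.coeFn_toLp] with x h3 h4 h5 h6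
    simp only [Pi.sub_apply, h3, h4, h5, h6]
    simp [T]
  rw [h2, ENNReal.le_ofReal_iff_toReal_le _ he.le]
  · exact h1.le
  · rw [← Lp.edist_def]; exact edist_ne_top _ _

/-- A nonnegative smooth kernel of integral one, supported in the ball of radius `δ`. -/
structure IsMollifier {n : ℕ} (η : Rn n → ℝ) (δ : ℝ) : Prop where
  smooth : ContDiff ℝ (⊤ : ℕ∞) η
  hasCompactSupport : HasCompactSupport η
  nonneg : ∀ z, 0 ≤ η z
  integral_eq_one : ∫ z, η z = 1
  tsupport_subset : tsupport η ⊆ Metric.ball 0 δ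

/-- The mollification `x ↦ ∫ η(y - x) f(y) dy = ∫ η(z) f(x + z) dz`. The kernel need not be
centred: it may push the argument of `f` in a given direction. -/
noncomputable def mollify {n : ℕ} {E : Type*} [NormedAddCommGroup E] [NormedSpace ℝ E]
    (η : Rn n → ℝ) (f : Rn n → E) (x : Rn n) : E := ∫ y, η (y - x) • f y

theorem mollify_eq {n : ℕ} {E : Type*} [NormedAddCommGroup E] [NormedSpace ℝ E]
    (η : Rn n → ℝ) (f : Rn n → E) (x : Rn n) : mollify η f x = ∫ z, η z • f (x + z) := by
  rw [mollify, ← integral_add_left_eq_self _ x]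
  simp

theorem integrable_smul_of_memLp {n : ℕ} {E : Type*} [NormedAddCommGroup E] [NormedSpace ℝ E]
    {η : Rn n → ℝ} (hc : Continuous η) (hs : HasCompactSupport η) {f : Rn n → E}
    {μ : Measure (Rn n)} [IsFiniteMeasureOnCompacts μ] (hf : MemLp f 2 μ) :
    Integrable (fun x => η x • f x) μ :=
  memLp_one_iff_integrable.mp (hf.smul (hc.memLp_of_hasCompactSupport hs (p := 2)))

/-- Jensen's inequality and Tonelli's theorem bound the `L²` distance between a function and its
mollification by the `L²` distance between the function and its small translates. -/
theorem eLpNorm_mollify_sub_le {n : ℕ} {E : Type*} [NormedAddCommGroup E] [NormedSpace ℝ E]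
    [CompleteSpace E] {η : Rn n → ℝ} {δ : ℝ} (hη : IsMollifier η δ) {f : Rn n → E}
    (hf : StronglyMeasurable f) (hf2 : MemLp f 2 volume) {ε : ℝ≥0∞}
    (hε : ∀ z, ‖z‖ < δ → eLpNorm (fun x => f (x + z) - f x) 2 volume ≤ ε) :
    eLpNorm (fun x => mollify η f x - f x) 2 volume ≤ ε := by
  have hηc := hη.smooth.continuous
  have hηi : Integrable η := hηc.integrable_of_hasCompactSupport hη.hasCompactSupport
  have hη1 : ∫⁻ z, ENNReal.ofReal (η z) = 1 := by
    rw [← ofReal_integral_eq_lintegral_ofReal hηi (Eventually.of_forall hη.nonneg),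
      hη.integral_eq_one, ENNReal.ofReal_one]
  have hηm : Measurable fun z => ENNReal.ofReal (η z) := hηc.measurable.ennreal_ofReal
  have key : ∀ x, ‖mollify η f x - f x‖ₑ ^ 2 ≤
      ∫⁻ z, ENNReal.ofReal (η z) * ‖f (x + z) - f x‖ₑ ^ 2 := by
    intro x
    have hd : StronglyMeasurable fun z => f (x + z) - f x :=
      (hf.comp_measurable (measurable_const_add x)).sub stronglyMeasurable_const
    have hint : Integrable fun z => η z • f (x + z) :=
      integrable_smul_of_memLp hηc hη.hasCompactSupport
        (hf2.comp_measurePreserving (measurePreserving_add_left volume x))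
    have h1 : mollify η f x - f x = ∫ z, η z • (f (x + z) - f x) := by
      simp_rw [smul_sub]
      rw [integral_sub hint (hηi.smul_const _), integral_smul_const, hη.integral_eq_one, one_smul,
        mollify_eq]
    set μ : Measure (Rn n) := volume.withDensity fun z => ENNReal.ofReal (η z) with hμ
    have : IsProbabilityMeasure μ := ⟨by rw [hμ, withDensity_apply _ .univ]; simpa using hη1⟩
    have h2 : ‖mollify η f x - f x‖ₑ ≤ eLpNorm (fun z => f (x + z) - f x) 1 μ := by
      rw [h1, eLpNorm_one_eq_lintegral_enorm, hμ,
        lintegral_withDensity_eq_lintegral_mul _ hηm hd.enorm]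
      refine (enorm_integral_le_lintegral_enorm _).trans_eq (lintegral_congr fun z => ?_)
      rw [enorm_smul, Pi.mul_apply, Real.enorm_of_nonneg (hη.nonneg z)]
    have h3 := h2.trans (eLpNorm_le_eLpNorm_of_exponent_le (q := 2) (by norm_num)
      hd.aestronglyMeasurable)
    calc ‖mollify η f x - f x‖ₑ ^ 2 ≤ eLpNorm (fun z => f (x + z) - f x) 2 μ ^ 2 := by gcongr
      _ = _ := by
        rw [eLpNorm_two_sq, hμ, lintegral_withDensity_eq_lintegral_mul _ hηm (hd.enorm.pow_const 2)]
        rfl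
  rw [← ENNReal.pow_le_pow_left_iff two_ne_zero, eLpNorm_two_sq]
  refine (lintegral_mono key).trans ?_
  rw [lintegral_lintegral_swap]
  · have hz : ∀ z, ∫⁻ x, ENNReal.ofReal (η z) * ‖f (x + z) - f x‖ₑ ^ 2 ≤
        ENNReal.ofReal (η z) * ε ^ 2 := by
      intro z
      rw [lintegral_const_mul' _ _ ENNReal.ofReal_ne_top]
      by_cases h0 : η z = 0
      · simp [h0]
      · have hz : ‖z‖ < δ := by simpa using hη.tsupport_subset (subset_tsupport _ h0)
        rw [← eLpNorm_two_sq (fun x => f (x + z) - f x)]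
        gcongr
        exact hε z hz
    refine (lintegral_mono hz).trans ?_
    rw [lintegral_mul_const _ hηm, hη1, one_mul]
  · have hm : StronglyMeasurable fun p : Rn n × Rn n => f (p.1 + p.2) - f p.1 :=
      (hf.comp_measurable measurable_add).sub (hf.comp_measurable measurable_fst)
    exact ((hηm.comp measurable_snd).mul (hm.enorm.pow_const 2)).aemeasurable

theorem mollify_eq_convolution {n : ℕ} (η : Rn n → ℝ) (f : Rn n → ℂ) :
    mollify η f = MeasureTheory.convolution f (fun w => η (-w))
      (ContinuousLinearMap.lsmul ℝ ℝ).flip volume := by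
  ext x
  simp [mollify, convolution]

theorem contDiff_mollify {n : ℕ} {η : Rn n → ℝ} (hη : ContDiff ℝ (⊤ : ℕ∞) η)
    (hs : HasCompactSupport η) {f : Rn n → ℂ} (hf : LocallyIntegrable f) :
    ContDiff ℝ (⊤ : ℕ∞) (mollify η f) := by
  rw [mollify_eq_convolution]
  exact (hs.comp_homeomorph (Homeomorph.neg _)).contDiff_convolution_right _ hf (hη.comp contDiff_neg)

theorem partialDeriv_mollify {n : ℕ} {η : Rn n → ℝ} (hη : ContDiff ℝ (⊤ : ℕ∞) η)
    (hs : HasCompactSupport η) {f : Rn n → ℂ} (hf : LocallyIntegrable f) (i : Fin n) (x : Rn n) :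
    partialDeriv (mollify η f) i x = -∫ y, partialDeriv η i (y - x) • f y := by
  have hs' : HasCompactSupport fun w => η (-w) := hs.comp_homeomorph (Homeomorph.neg _)
  have hη' : ContDiff ℝ (⊤ : ℕ∞) fun w => η (-w) := hη.comp contDiff_neg
  have h := hs'.hasFDerivAt_convolution_right (μ := volume)
    (ContinuousLinearMap.lsmul ℝ ℝ (E := ℂ)).flip hf (hη'.of_le (by simp)) x
  rw [partialDeriv, mollify_eq_convolution, h.fderiv, convolution_precompR_apply _ hf
    (hs'.fderiv ℝ) (hη'.continuous_fderiv (by simp)), convolution, ← integral_neg]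
  refine integral_congr_ae (Eventually.of_forall fun y => ?_)
  have h2 : fderiv ℝ (fun w => η (-w)) (x - y) = -fderiv ℝ η (y - x) := by
    have h3 := ((hη.differentiable (by simp)) (-(x - y))).hasFDerivAt.comp (x - y)
      (hasFDerivAt_id (𝕜 := ℝ) (x - y)).neg
    have h4 := h3.fderiv
    simp only [Function.comp_def] at h4
    rw [h4]
    ext v
    simp
  simp [h2, partialDeriv]

/-! ### Density of smooth functions in `H¹(Ω)` -/

/-- The gradient of a real-valued function, as a vector of `ℂⁿ`. -/
noncomputable def realGrad {n : ℕ} (ρ : Rn n → ℝ) (x : Rn n) : Cn n :=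
  WithLp.toLp 2 fun i => ((partialDeriv ρ i x : ℝ) : ℂ)

theorem continuous_realGrad {n : ℕ} {ρ : Rn n → ℝ} (hρ : ContDiff ℝ (⊤ : ℕ∞) ρ) :
    Continuous (realGrad ρ) :=
  (PiLp.continuous_toLp 2 _).comp (continuous_pi fun i =>
    Complex.continuous_ofReal.comp (continuous_partialDeriv hρ i))

theorem hasCompactSupport_realGrad {n : ℕ} {ρ : Rn n → ℝ} (hs : HasCompactSupport ρ) :
    HasCompactSupport (realGrad ρ) :=
  (hs.fderiv ℝ).comp_left (g := fun L : Rn n →L[ℝ] ℝ =>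
    (WithLp.toLp 2 fun i => ((L (EuclideanSpace.single i 1) : ℝ) : ℂ) : Cn n)) (by ext i; simp)

/-- The cut-off `ρ u`, extended by zero outside `Ω`. -/
noncomputable def cutFn {n : ℕ} {Ω : Set (Rn n)} (ρ : Rn n → ℝ) (u : H1 Ω) : Rn n → ℂ :=
  Ω.indicator fun y => ρ y • fn u y

/-- The gradient `ρ ∇u + u ∇ρ` of the cut-off `ρ u`, extended by zero outside `Ω`. -/
noncomputable def cutGrad {n : ℕ} {Ω : Set (Rn n)} (ρ : Rn n → ℝ) (u : H1 Ω) : Rn n → Cn n :=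
  Ω.indicator fun y => ρ y • grad u y + fn u y • realGrad ρ y

section

variable {n : ℕ} {Ω : Set (Rn n)} {ρ : Rn n → ℝ}

theorem stronglyMeasurable_cutFn (hO : IsOpen Ω) (hρ : Continuous ρ) (u : H1 Ω) :
    StronglyMeasurable (cutFn ρ u) :=
  (hρ.stronglyMeasurable.smul (Lp.stronglyMeasurable (fn u))).indicator hO.measurableSet

theorem stronglyMeasurable_cutGrad (hO : IsOpen Ω) (hρ : ContDiff ℝ (⊤ : ℕ∞) ρ) (u : H1 Ω) :
    StronglyMeasurable (cutGrad ρ u) :=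
  ((hρ.continuous.stronglyMeasurable.smul (Lp.stronglyMeasurable (grad u))).add
    ((Lp.stronglyMeasurable (fn u)).smul (continuous_realGrad hρ).stronglyMeasurable)).indicator
      hO.measurableSet

theorem memLp_cutFn (hO : IsOpen Ω) (hρ : Continuous ρ) (hs : HasCompactSupport ρ) (u : H1 Ω) :
    MemLp (cutFn ρ u) 2 volume :=
  (memLp_indicator_iff_restrict hO.measurableSet).2
    ((Lp.memLp (fn u)).smul (hρ.memLp_of_hasCompactSupport hs (p := ∞)))

theorem memLp_cutGrad (hO : IsOpen Ω) (hρ : ContDiff ℝ (⊤ : ℕ∞) ρ) (hs : HasCompactSupport ρ)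
    (u : H1 Ω) : MemLp (cutGrad ρ u) 2 volume :=
  (memLp_indicator_iff_restrict hO.measurableSet).2
    (((Lp.memLp (grad u)).smul (hρ.continuous.memLp_of_hasCompactSupport hs (p := ∞))).add
      (((continuous_realGrad hρ).memLp_of_hasCompactSupport (hasCompactSupport_realGrad hs)
        (p := ∞)).smul (Lp.memLp (fn u))))

/-- Where the kernel does not reach outside the domain, the gradient of the mollified cut-off is
the mollification of the weak gradient of the cut-off. -/
theorem gradVec_mollify_cutFn (hO : IsOpen Ω) (hρ : ContDiff ℝ (⊤ : ℕ∞) ρ)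
    (hs : HasCompactSupport ρ) (u : H1 Ω) {η : Rn n → ℝ} {δ : ℝ} (hη : IsMollifier η δ) {x : Rn n}
    (hx : ∀ z ∈ tsupport η, x + z ∈ tsupport ρ → x + z ∈ Ω) :
    gradVec (mollify η (cutFn ρ u)) x = mollify η (cutGrad ρ u) x := by
  set ηx : Rn n → ℝ := fun y => η (y - x) with hηx
  have hηxs : ContDiff ℝ (⊤ : ℕ∞) ηx := hη.smooth.comp (contDiff_id.sub contDiff_const)
  have hηxc : HasCompactSupport ηx := by
    have := hη.hasCompactSupport.comp_homeomorph (Homeomorph.addRight (-x))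
    simpa [Function.comp_def, ← sub_eq_add_neg] using this
  set ψ : Rn n → ℝ := fun y => ηx y * ρ y with hψ
  have hψs : ContDiff ℝ (⊤ : ℕ∞) ψ := hηxs.mul hρ
  have hψc : HasCompactSupport ψ := hηxc.mul_right
  have hψt : tsupport ψ ⊆ Ω := by
    intro y hy
    have h1 : y - x ∈ tsupport η :=
      tsupport_comp_subset_preimage η (f := fun y => y - x) (by fun_prop)
        (tsupport_mul_subset_left hy)
    have h2 := hx (y - x) h1
    rw [add_sub_cancel] at h2
    exact h2 (tsupport_mul_subset_right hy)
  have hd : ∀ i y, partialDeriv ψ i y = partialDeriv η i (y - x) * ρ y + ηx y * partialDeriv ρ i y := by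
    intro i y
    have h1 : HasFDerivAt ηx (fderiv ℝ η (y - x)) y := by
      exact ((hη.smooth.differentiable (by simp)) (y - x)).hasFDerivAt.comp y
        ((hasFDerivAt_id (𝕜 := ℝ) y).sub_const x)
    have h2 : HasFDerivAt ψ (ηx y • fderiv ℝ ρ y + ρ y • fderiv ℝ η (y - x)) y :=
      h1.mul ((hρ.differentiable (by simp)) y).hasFDerivAt
    rw [partialDeriv, h2.fderiv]
    simp [partialDeriv]
    ring
  have hint : Integrable fun y => η (y - x) • cutGrad ρ u y :=
    integrable_smul_of_memLp hηxs.continuous hηxc (memLp_cutGrad hO hρ hs u)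
  ext i
  have hL : gradVec (mollify η (cutFn ρ u)) x i =
      -∫ y in Ω, partialDeriv η i (y - x) • ρ y • fn u y := by
    change partialDeriv (mollify η (cutFn ρ u)) i x = _
    rw [partialDeriv_mollify hη.smooth hη.hasCompactSupport
      ((memLp_cutFn hO hρ.continuous hs u).locallyIntegrable (by norm_num)),
      ← integral_indicator hO.measurableSet]
    congr 1
    refine integral_congr_ae (Eventually.of_forall fun y => ?_)
    by_cases hy : y ∈ Ω <;> simp [cutFn, hy]
  have hR : mollify η (cutGrad ρ u) x i =
      ∫ y in Ω, (ψ y • grad u y i + (ηx y * partialDeriv ρ i y) • fn u y) := by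
    have h1 := (EuclideanSpace.proj (𝕜 := ℂ) i : Cn n →L[ℂ] ℂ).integral_comp_comm hint
    change (EuclideanSpace.proj (𝕜 := ℂ) i : Cn n →L[ℂ] ℂ) (∫ y, η (y - x) • cutGrad ρ u y) = _
    rw [← h1, ← integral_indicator hO.measurableSet]
    refine integral_congr_ae (Eventually.of_forall fun y => ?_)
    by_cases hy : y ∈ Ω
    · simp [cutGrad, hy, realGrad, hψ, hηx]
      ring
    · simp [cutGrad, hy]
  have hw := u.2 ψ hψs hψc hψt i
  have hi1 : Integrable (fun y => ψ y • grad u y i) (vol Ω) :=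
    integrable_smul_of_test hψs.continuous hψc (memLp_coord _ i)
  have hi2 : Integrable (fun y => (ηx y * partialDeriv ρ i y) • fn u y) (vol Ω) :=
    integrable_smul_of_test (hηxs.continuous.mul (continuous_partialDeriv hρ i)) hηxc.mul_right
      (Lp.memLp _)
  have hi3 : Integrable (fun y => partialDeriv ψ i y • fn u y) (vol Ω) :=
    integrable_smul_of_test (continuous_partialDeriv hψs i) (hasCompactSupport_partialDeriv hψc i)
      (Lp.memLp _)
  have h3 : ∫ y in Ω, partialDeriv η i (y - x) • ρ y • fn u y =
      (∫ y in Ω, partialDeriv ψ i y • fn u y) -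
        ∫ y in Ω, (ηx y * partialDeriv ρ i y) • fn u y := by
    rw [← integral_sub hi3 hi2]
    refine integral_congr_ae (Eventually.of_forall fun y => ?_)
    simp only [hd, ← sub_smul, add_sub_cancel_right, smul_smul]
  rw [hL, hR, integral_add hi1 hi2, h3]
  change _ = -∫ y in Ω, ψ y • grad u y i at hw
  change -((∫ y in Ω, partialDeriv ψ i y • fn u y) - _) = _
  change (∫ y in Ω, partialDeriv ψ i y • fn u y) = _ at hw
  rw [hw]
  ring

/-- `V` is reached by mollification from within `Ω`: there are arbitrarily small kernels that do
not lead from `Ω` to points of `V` outside `Ω`. -/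
def Reachable (Ω V : Set (Rn n)) : Prop :=
  ∀ δ > 0, ∃ η : Rn n → ℝ, IsMollifier η δ ∧ ∀ x ∈ Ω, ∀ z ∈ tsupport η, x + z ∈ V → x + z ∈ Ω

/-- A cut-off of an `H¹` function is a limit in `H¹(Ω)` of smooth functions. -/
theorem exists_smooth_approx_cutFn (hO : IsOpen Ω) (hρ : ContDiff ℝ (⊤ : ℕ∞) ρ)
    (hs : HasCompactSupport ρ) {V : Set (Rn n)} (hV : Reachable Ω V) (hρV : tsupport ρ ⊆ V)
    (u : H1 Ω) {ε : ℝ≥0∞} (hε : ε ≠ 0) :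
    ∃ φ : Rn n → ℂ, ContDiff ℝ (⊤ : ℕ∞) φ ∧
      eLpNorm (fun x => φ x - ρ x • fn u x) 2 (vol Ω) ≤ ε ∧
      eLpNorm (fun x => gradVec φ x - (ρ x • grad u x + fn u x • realGrad ρ x)) 2 (vol Ω) ≤ ε := by
  have hf := memLp_cutFn hO hρ.continuous hs u
  have hg := memLp_cutGrad hO hρ hs u
  obtain ⟨δ₁, hδ₁, h₁⟩ := exists_translation_le hf hε
  obtain ⟨δ₂, hδ₂, h₂⟩ := exists_translation_le hg hε
  obtain ⟨η, hη, hηV⟩ := hV (min δ₁ δ₂) (lt_min hδ₁ hδ₂)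
  refine ⟨mollify η (cutFn ρ u), contDiff_mollify hη.smooth hη.hasCompactSupport
    (hf.locallyIntegrable (by norm_num)), ?_, ?_⟩
  · refine le_trans ?_ (eLpNorm_mollify_sub_le hη (stronglyMeasurable_cutFn hO hρ.continuous u) hf
      fun z hz => h₁ z (hz.trans_le (min_le_left _ _)))
    refine le_trans (le_of_eq (eLpNorm_congr_ae ?_)) (eLpNorm_mono_measure _ Measure.restrict_le_self)
    filter_upwards [ae_restrict_mem hO.measurableSet] with x hx
    simp [cutFn, hx]
  · refine le_trans ?_ (eLpNorm_mollify_sub_le hη (stronglyMeasurable_cutGrad hO hρ u) hg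
      fun z hz => h₂ z (hz.trans_le (min_le_right _ _)))
    refine le_trans (le_of_eq (eLpNorm_congr_ae ?_)) (eLpNorm_mono_measure _ Measure.restrict_le_self)
    filter_upwards [ae_restrict_mem hO.measurableSet] with x hx
    rw [gradVec_mollify_cutFn hO hρ hs u hη fun z hz hzρ => hηV x hx z hz (hρV hzρ)]
    simp [cutGrad, hx]

theorem exists_isMollifier_subset_closedBall {c : Rn n} {b δ : ℝ} (hb : 0 < b)
    (hδ : Metric.closedBall c b ⊆ Metric.ball 0 δ) :
    ∃ η : Rn n → ℝ, IsMollifier η δ ∧ tsupport η ⊆ Metric.closedBall c b := by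
  let f : ContDiffBump c := ⟨b / 2, b, by positivity, by linarith⟩
  have ht : tsupport (f.normed volume) = Metric.closedBall c b := f.tsupport_normed_eq
  exact ⟨f.normed volume, ⟨f.contDiff_normed, f.hasCompactSupport_normed, f.nonneg_normed,
    f.integral_normed, ht.trans_subset hδ⟩, ht.subset⟩

theorem reachable_of_subset {V : Set (Rn n)} (h : V ⊆ Ω) : Reachable Ω V := fun δ hδ => by
  obtain ⟨η, hη, -⟩ := exists_isMollifier_subset_closedBall (c := (0 : Rn n)) (half_pos hδ)
    (Metric.closedBall_subset_ball (half_lt_self hδ))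
  exact ⟨η, hη, fun _ _ _ _ hz => h hz⟩

/-- Near a boundary point, kernels supported well inside the vertical cone above the origin push
the argument into the domain. -/
theorem IsBoundedLipschitzDomain.exists_reachable_ball (hΩ : IsBoundedLipschitzDomain Ω)
    {x₀ : Rn n} (hx₀ : x₀ ∈ closure Ω) : ∃ r > 0, Reachable Ω (Metric.ball x₀ r) := by
  by_cases hin : x₀ ∈ Ω
  · obtain ⟨r, hr, hsub⟩ := Metric.isOpen_iff.1 hΩ.isOpen x₀ hin
    exact ⟨r, hr, reachable_of_subset hsub⟩
  obtain ⟨ν, K, g, r, hr, hν, hg, hinv, hball, -, -⟩ :=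
    hΩ.exists_local_graph (x₀ := x₀) (by rw [hΩ.isOpen.frontier_eq]; exact ⟨hx₀, hin⟩)
  refine ⟨r, hr, fun δ' hδ' => ?_⟩
  obtain ⟨δ, hδ, hδle, hδr⟩ : ∃ δ : ℝ, 0 < δ ∧ δ ≤ δ' ∧ δ ≤ r :=
    ⟨min δ' r, lt_min hδ' hr, min_le_left _ _, min_le_right _ _⟩
  -- the kernel is centred at `(δ / 2) ν`; its radius `b` satisfies `(K + 1) b < δ / 2`
  set b : ℝ := δ / (4 * (K + 1)) with hb
  have hK : (0 : ℝ) ≤ K := K.2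
  have hb0 : 0 < b := by positivity
  have hKb : (K + 1) * b = δ / 4 := by rw [hb]; field_simp
  have hsub : Metric.closedBall ((δ / 2) • ν) b ⊆ Metric.ball 0 δ := by
    intro z hz
    rw [Metric.mem_closedBall, dist_eq_norm] at hz
    have h1 : ‖(δ / 2) • ν‖ = δ / 2 := by
      rw [norm_smul, hν, mul_one, Real.norm_of_nonneg (by positivity)]
    have h2 := norm_add_le (z - (δ / 2) • ν) ((δ / 2) • ν)
    rw [sub_add_cancel] at h2
    rw [mem_ball_zero_iff]
    nlinarith
  obtain ⟨η, hη, hηs⟩ := exists_isMollifier_subset_closedBall hb0 hsub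
  refine ⟨η, { hη with tsupport_subset := hη.tsupport_subset.trans (Metric.ball_subset_ball hδle) },
    fun x hx z hz hxz => ?_⟩
  have hzδ : ‖z‖ < δ := by simpa using hη.tsupport_subset hz
  have hzb := hηs hz
  rw [Metric.mem_closedBall, dist_eq_norm] at hzb
  rw [Metric.mem_ball, dist_eq_norm] at hxz
  have hxb : x ∈ Metric.ball x₀ (2 * r) := by
    rw [Metric.mem_ball, dist_eq_norm]
    calc ‖x - x₀‖ = ‖(x + z - x₀) - z‖ := by congr 1; abel
      _ ≤ ‖x + z - x₀‖ + ‖z‖ := norm_sub_le _ _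
      _ < 2 * r := by linarith
  have hxzb : x + z ∈ Metric.ball x₀ (2 * r) := by
    rw [Metric.mem_ball, dist_eq_norm]; linarith
  rw [hball _ hxzb]
  have h1 := (hball x hxb).1 hx
  set w := z - (δ / 2) • ν with hw
  have hz' : z = w + (δ / 2) • ν := by rw [hw, sub_add_cancel]
  have h2 : g (x + z) = g (x + w) := by rw [hz', ← add_assoc, hinv]
  have h3 : g (x + w) ≤ g x + K * ‖w‖ := by
    have := hg.dist_le_mul (x + w) x
    rw [Real.dist_eq, dist_eq_norm, add_sub_cancel_left] at this
    linarith [(abs_le.1 this).2]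
  have h4 : inner ℝ ν z = inner ℝ ν w + δ / 2 := by
    rw [hz', inner_add_right, inner_smul_right, real_inner_self_eq_norm_sq, hν]; ring
  have h5 : -‖w‖ ≤ inner ℝ ν w := by
    have := abs_real_inner_le_norm ν w
    rw [hν, one_mul] at this
    exact (abs_le.1 this).1
  rw [h2, inner_add_right, h4]
  nlinarith

/-- Smooth functions on `ℝⁿ` are dense in `H¹(Ω)`, for a bounded Lipschitz domain `Ω`. -/
theorem IsBoundedLipschitzDomain.exists_smooth_approx (hΩ : IsBoundedLipschitzDomain Ω) (u : H1 Ω)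
    {ε : ℝ≥0∞} (hε : ε ≠ 0) :
    ∃ φ : Rn n → ℂ, ContDiff ℝ (⊤ : ℕ∞) φ ∧
      eLpNorm (fun x => φ x - fn u x) 2 (vol Ω) ≤ ε ∧
      eLpNorm (fun x => gradVec φ x - grad u x) 2 (vol Ω) ≤ ε := by
  have hcomp : IsCompact (closure Ω) :=
    Metric.isCompact_of_isClosed_isBounded isClosed_closure hΩ.isBounded.closure
  have hO := hΩ.isOpen
  choose! r hr hV using fun x₀ (h : x₀ ∈ closure Ω) => hΩ.exists_reachable_ball h
  obtain ⟨t, ht, hcov⟩ := hcomp.elim_nhds_subcover (fun x => Metric.ball x (r x))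
    fun x hx => Metric.ball_mem_nhds x (hr x hx)
  obtain ⟨f, hf⟩ := SmoothPartitionOfUnity.exists_isSubordinate (modelWithCornersSelf ℝ (Rn n))
    (s := closure Ω) isClosed_closure (fun i : t => Metric.ball (i : Rn n) (r i))
    (fun i => Metric.isOpen_ball) (by simpa [iUnion_subtype] using hcov)
  have hfs : ∀ i, ContDiff ℝ (⊤ : ℕ∞) (f i) := fun i => (f i).contMDiff.contDiff
  have hfc : ∀ i, HasCompactSupport (f i) := fun i =>
    (isCompact_closedBall (i : Rn n) (r i)).of_isClosed_subset (isClosed_tsupport _)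
      ((hf i).trans Metric.ball_subset_closedBall)
  have hsum : ∀ x ∈ Ω, ∑ i, f i x = 1 := fun x hx => by
    rw [← finsum_eq_sum_of_fintype]; exact f.sum_eq_one (subset_closure hx)
  have hgsum : ∀ x ∈ Ω, ∑ i, realGrad (f i) x = 0 := by
    intro x hx
    have h1 : HasFDerivAt (fun y => ∑ i, f i y) (∑ i, fderiv ℝ (f i) x) x :=
      HasFDerivAt.fun_sum fun i _ => ((hfs i).differentiable (by simp) x).hasFDerivAt
    have h2 : HasFDerivAt (fun y => ∑ i, f i y) (0 : Rn n →L[ℝ] ℝ) x :=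
      (hasFDerivAt_const (1 : ℝ) x).congr_of_eventuallyEq
        (Filter.eventually_of_mem (hO.mem_nhds hx) hsum)
    have h3 := h1.unique h2
    ext j
    have h4 := DFunLike.congr_fun h3 (EuclideanSpace.single j 1)
    simp only [sum_apply, zero_apply] at h4
    simp only [WithLp.ofLp_sum, Finset.sum_apply, realGrad, partialDeriv, ← Complex.ofReal_sum, h4]
    simp
  have hε' : ε / (Fintype.card t + 1) ≠ 0 := ENNReal.div_ne_zero.2 ⟨hε, by finiteness⟩
  choose φ hφs hφ1 hφ2 using fun i : t =>
    exists_smooth_approx_cutFn hO (hfs i) (hfc i) (hV i (ht i i.2)) (hf i) u hε'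
  have hcard : ∑ _i : t, ε / (Fintype.card t + 1) ≤ ε := by
    rw [Finset.sum_const, Finset.card_univ, nsmul_eq_mul, ← mul_div_assoc]
    refine ENNReal.div_le_of_le_mul ?_
    rw [mul_comm]
    gcongr
    exact le_self_add
  refine ⟨fun x => ∑ i, φ i x, ContDiff.sum fun i _ => hφs i, ?_, ?_⟩
  · refine le_trans ?_ ((Finset.sum_le_sum fun i _ => hφ1 i).trans hcard)
    refine le_trans (le_of_eq (eLpNorm_congr_ae ?_)) (eLpNorm_sum_le (fun i _ => ?_) (by norm_num))
    · filter_upwards [ae_restrict_mem hO.measurableSet] with x hx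
      rw [Finset.sum_apply, Finset.sum_sub_distrib, ← Finset.sum_smul, hsum x hx, one_smul]
    · exact (hφs i).continuous.aestronglyMeasurable.sub
        ((hfs i).continuous.aestronglyMeasurable.smul (Lp.aestronglyMeasurable _))
  · refine le_trans ?_ ((Finset.sum_le_sum fun i _ => hφ2 i).trans hcard)
    refine le_trans (le_of_eq (eLpNorm_congr_ae ?_)) (eLpNorm_sum_le (fun i _ => ?_) (by norm_num))
    · filter_upwards [ae_restrict_mem hO.measurableSet] with x hx
      rw [Finset.sum_apply, Finset.sum_sub_distrib, Finset.sum_add_distrib, ← Finset.sum_smul,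
        ← Finset.smul_sum, hsum x hx, hgsum x hx, one_smul, smul_zero, add_zero]
      congr 1
      ext j
      simp only [gradVec, partialDeriv, WithLp.ofLp_sum, Finset.sum_apply]
      rw [fderiv_fun_sum fun i _ => (hφs i).differentiable (by simp) x]
      simp
    · exact (continuous_gradVec (hφs i)).aestronglyMeasurable.sub
        (((hfs i).continuous.aestronglyMeasurable.smul (Lp.aestronglyMeasurable _)).add
          ((Lp.aestronglyMeasurable (fn u)).smul (continuous_realGrad (hfs i)).aestronglyMeasurable))

end

/-! ### The trace operator -/

/-- The space of smooth complex-valued functions on `ℝⁿ`. -/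
def smoothFns (n : ℕ) : Submodule ℂ (Rn n → ℂ) where
  carrier := {φ | ContDiff ℝ (⊤ : ℕ∞) φ}
  zero_mem' := (contDiff_const : ContDiff ℝ (⊤ : ℕ∞) fun _ : Rn n => (0 : ℂ))
  add_mem' {φ ψ} (hφ : ContDiff ℝ (⊤ : ℕ∞) φ) (hψ : ContDiff ℝ (⊤ : ℕ∞) ψ) :=
    (hφ.add hψ : ContDiff ℝ (⊤ : ℕ∞) (φ + ψ))
  smul_mem' c φ (hφ : ContDiff ℝ (⊤ : ℕ∞) φ) :=
    (contDiff_const.smul hφ : ContDiff ℝ (⊤ : ℕ∞) (c • φ))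

theorem contDiff_coe {n : ℕ} (φ : smoothFns n) : ContDiff ℝ (⊤ : ℕ∞) (φ : Rn n → ℂ) := φ.2

section

variable {n : ℕ} {Ω : Set (Rn n)}

theorem gradVec_add {φ ψ : Rn n → ℂ} (hφ : ContDiff ℝ (⊤ : ℕ∞) φ) (hψ : ContDiff ℝ (⊤ : ℕ∞) ψ) :
    gradVec (φ + ψ) = gradVec φ + gradVec ψ := by
  ext x i
  simp [gradVec, partialDeriv, fderiv_add (hφ.differentiable (by simp) x)
    (hψ.differentiable (by simp) x)]

theorem gradVec_smul {φ : Rn n → ℂ} (hφ : ContDiff ℝ (⊤ : ℕ∞) φ) (c : ℂ) :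
    gradVec (c • φ) = c • gradVec φ := by
  ext x i
  simp [gradVec, partialDeriv, fderiv_const_smul (hφ.differentiable (by simp) x)]

/-- The trace inequality in terms of `L²` norms. -/
theorem eLpNorm_surf_le (hn : 1 ≤ n) (hΩ : IsBoundedLipschitzDomain Ω) :
    ∃ C : ℝ≥0, ∀ φ : Rn n → ℂ, ContDiff ℝ (⊤ : ℕ∞) φ →
      eLpNorm φ 2 (surf Ω) ≤ C * (eLpNorm φ 2 (vol Ω) + eLpNorm (gradVec φ) 2 (vol Ω)) := by
  obtain ⟨C, hC⟩ := trace_inequality hn hΩ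
  refine ⟨C + 1, fun φ hφ => ?_⟩
  rw [← ENNReal.pow_le_pow_left_iff two_ne_zero, mul_pow]
  have h := hC φ hφ
  rw [← eLpNorm_two_sq, ← eLpNorm_two_sq, ← eLpNorm_two_sq] at h
  have h1 : (C : ℝ≥0∞) ≤ ((C + 1 : ℝ≥0) : ℝ≥0∞) ^ 2 := by
    norm_cast
    nlinarith [C.2, sq_nonneg C]
  refine h.trans (mul_le_mul' h1 ?_)
  rw [add_sq]
  gcongr
  exact le_self_add

theorem memLp_vol_of_continuous {E : Type*} [NormedAddCommGroup E] (hb : Bornology.IsBounded Ω)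
    {f : Rn n → E} (hf : Continuous f) : MemLp f 2 (vol Ω) := by
  have hcomp : IsCompact (closure Ω) :=
    Metric.isCompact_of_isClosed_isBounded isClosed_closure hb.closure
  have : IsFiniteMeasure (volume.restrict (closure Ω)) :=
    isFiniteMeasure_restrict.2 hcomp.measure_lt_top.ne
  obtain ⟨C, hC⟩ := hcomp.exists_bound_of_continuousOn hf.continuousOn
  refine (MemLp.of_bound (μ := volume.restrict (closure Ω)) hf.aestronglyMeasurable C
    ?_).mono_measure (Measure.restrict_mono subset_closure le_rfl)
  filter_upwards [ae_restrict_mem isClosed_closure.measurableSet] with x hx using hC x hx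

theorem memLp_surf (hn : 1 ≤ n) (hΩ : IsBoundedLipschitzDomain Ω) {φ : Rn n → ℂ}
    (hφ : ContDiff ℝ (⊤ : ℕ∞) φ) : MemLp φ 2 (surf Ω) := by
  obtain ⟨C, hC⟩ := eLpNorm_surf_le hn hΩ
  refine ⟨hφ.continuous.aestronglyMeasurable, (hC φ hφ).trans_lt ?_⟩
  exact ENNReal.mul_lt_top ENNReal.coe_lt_top (ENNReal.add_lt_top.2
    ⟨(memLp_vol_of_continuous hΩ.isBounded hφ.continuous).2,
      (memLp_vol_of_continuous hΩ.isBounded (continuous_gradVec hφ)).2⟩)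

/-- The boundary of a bounded Lipschitz domain has finite surface measure. -/
theorem isFiniteMeasure_surf (hn : 1 ≤ n) (hΩ : IsBoundedLipschitzDomain Ω) :
    IsFiniteMeasure (surf Ω) := by
  have h := memLp_surf hn hΩ (φ := fun _ => 1) contDiff_const
  rw [memLp_const_iff (by simp) (by simp)] at h
  exact ⟨h.resolve_left one_ne_zero⟩

/-- The space `(L²(Ω) × L²(Ω)ⁿ) × L²(∂Ω)`. -/
abbrev TraceTriple (Ω : Set (Rn n)) : Type :=
  (Lp ℂ 2 (vol Ω) × Lp (Cn n) 2 (vol Ω)) × Lp ℂ 2 (surf Ω)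

/-- A smooth function `φ` gives the triple `((φ, ∇φ), φ|∂Ω)` in `(L²(Ω) × L²(Ω)ⁿ) × L²(∂Ω)`. -/
noncomputable def traceData (hn : 1 ≤ n) (hΩ : IsBoundedLipschitzDomain Ω) :
    smoothFns n →ₗ[ℂ] TraceTriple Ω where
  toFun φ := (((memLp_vol_of_continuous hΩ.isBounded ((contDiff_coe φ).continuous)).toLp _,
    (memLp_vol_of_continuous hΩ.isBounded (continuous_gradVec (contDiff_coe φ))).toLp _),
    (memLp_surf hn hΩ (contDiff_coe φ)).toLp _)
  map_add' φ ψ := by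
    have v := fun φ : smoothFns n => memLp_vol_of_continuous hΩ.isBounded (contDiff_coe φ).continuous
    have g := fun φ : smoothFns n =>
      memLp_vol_of_continuous hΩ.isBounded (continuous_gradVec (contDiff_coe φ))
    have t := fun φ : smoothFns n => memLp_surf hn hΩ (contDiff_coe φ)
    refine Prod.ext (Prod.ext (MemLp.toLp_add (v φ) (v ψ)) ?_) (MemLp.toLp_add (t φ) (t ψ))
    exact (MemLp.toLp_congr (g (φ + ψ)) ((g φ).add (g ψ)) (Eventually.of_forall
      (congrFun (gradVec_add (contDiff_coe φ) (contDiff_coe ψ))))).trans (MemLp.toLp_add (g φ) (g ψ))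
  map_smul' c φ := by
    have v := fun φ : smoothFns n => memLp_vol_of_continuous hΩ.isBounded (contDiff_coe φ).continuous
    have g := fun φ : smoothFns n =>
      memLp_vol_of_continuous hΩ.isBounded (continuous_gradVec (contDiff_coe φ))
    have t := fun φ : smoothFns n => memLp_surf hn hΩ (contDiff_coe φ)
    refine Prod.ext (Prod.ext (MemLp.toLp_const_smul c (v φ)) ?_) (MemLp.toLp_const_smul c (t φ))
    exact (MemLp.toLp_congr (g (c • φ)) ((g φ).const_smul c) (Eventually.of_forall
      (congrFun (gradVec_smul (contDiff_coe φ) c)))).trans (MemLp.toLp_const_smul c (g φ))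

/-- The relation `HasTrace` is the closure of the graph of the classical trace. -/
theorem hasTrace_iff (hn : 1 ≤ n) (hΩ : IsBoundedLipschitzDomain Ω) (u : H1 Ω)
    (t : Lp ℂ 2 (surf Ω)) :
    HasTrace u t ↔ ((fn u, grad u), t) ∈ (traceData hn hΩ).range.topologicalClosure := by
  have key : ∀ φ : ℕ → smoothFns n,
      Tendsto (fun k => traceData hn hΩ (φ k)) atTop (𝓝 ((fn u, grad u), t)) ↔
      (Tendsto (fun k => eLpNorm (fun x => (φ k : Rn n → ℂ) x - fn u x) 2 (vol Ω)) atTop (𝓝 0) ∧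
      Tendsto (fun k => eLpNorm (fun x => gradVec (φ k) x - grad u x) 2 (vol Ω)) atTop (𝓝 0)) ∧
      Tendsto (fun k => eLpNorm (fun x => (φ k : Rn n → ℂ) x - t x) 2 (surf Ω)) atTop (𝓝 0) := by
    intro φ
    have h1 := Lp.tendsto_Lp_iff_tendsto_eLpNorm'' (fi := atTop) (fun k => (φ k : Rn n → ℂ))
      (fun k => memLp_vol_of_continuous hΩ.isBounded ((contDiff_coe (φ k)).continuous)) _ (Lp.memLp (fn u))
    have h2 := Lp.tendsto_Lp_iff_tendsto_eLpNorm'' (fi := atTop) (fun k => gradVec (φ k))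
      (fun k => memLp_vol_of_continuous hΩ.isBounded (continuous_gradVec (contDiff_coe (φ k)))) _
      (Lp.memLp (grad u))
    have h3 := Lp.tendsto_Lp_iff_tendsto_eLpNorm'' (fi := atTop) (fun k => (φ k : Rn n → ℂ))
      (fun k => memLp_surf hn hΩ (contDiff_coe (φ k))) _ (Lp.memLp t)
    rw [Lp.toLp_coeFn] at h1 h2 h3
    rw [Prod.tendsto_iff, Prod.tendsto_iff]
    exact and_congr (and_congr h1 h2) h3
  constructor
  · rintro ⟨φ, hφ, h1, h2, h3⟩
    exact mem_closure_of_tendsto ((key fun k => (⟨φ k, hφ k⟩ : smoothFns n)).2 ⟨⟨h1, h2⟩, h3⟩)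
      (Eventually.of_forall fun k => ⟨_, rfl⟩)
  · intro h
    obtain ⟨x, hx, hlim⟩ := mem_closure_iff_seq_limit.1 h
    choose φ hφ using hx
    obtain ⟨⟨h1, h2⟩, h3⟩ := (key φ).1 (by simpa only [hφ] using hlim)
    exact ⟨fun k => φ k, fun k => (contDiff_coe (φ k)), h1, h2, h3⟩

/-- The trace inequality for limits of smooth functions. -/
theorem norm_le_of_mem_closure (hn : 1 ≤ n) (hΩ : IsBoundedLipschitzDomain Ω) :
    ∃ C : ℝ≥0, ∀ x ∈ (traceData hn hΩ).range.topologicalClosure, ‖x.2‖ ≤ C * ‖x.1‖ := by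
  obtain ⟨C, hC⟩ := eLpNorm_surf_le hn hΩ
  refine ⟨C * 2, fun x hx => ?_⟩
  refine closure_minimal (s := ((traceData hn hΩ).range : Set (TraceTriple Ω)))
    (t := {x : TraceTriple Ω | ‖x.2‖ ≤ (C * 2 : ℝ≥0) * ‖x.1‖}) ?_ (isClosed_le (by fun_prop) (by fun_prop)) hx
  rintro _ ⟨φ, rfl⟩
  have h1 := memLp_vol_of_continuous hΩ.isBounded ((contDiff_coe φ).continuous)
  have h2 := memLp_vol_of_continuous hΩ.isBounded (continuous_gradVec (contDiff_coe φ))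
  have h := ENNReal.toReal_mono (ENNReal.mul_lt_top ENNReal.coe_lt_top
    (ENNReal.add_lt_top.2 ⟨h1.2, h2.2⟩)).ne (hC φ (contDiff_coe φ))
  rw [ENNReal.toReal_mul, ENNReal.toReal_add h1.2.ne h2.2.ne, ENNReal.coe_toReal,
    ← Lp.norm_toLp _ h1, ← Lp.norm_toLp _ h2, ← Lp.norm_toLp _ (memLp_surf hn hΩ (contDiff_coe φ))] at h
  have h3 := norm_fst_le (traceData hn hΩ φ).1
  have h4 := norm_snd_le (traceData hn hΩ φ).1
  refine h.trans ?_
  rw [NNReal.coe_mul, mul_assoc]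
  refine mul_le_mul_of_nonneg_left ?_ C.2
  rw [NNReal.coe_ofNat, two_mul]
  exact add_le_add h3 h4

/-- Every `H¹` function has a trace: the projection from the closure of the graph of the classical
trace has closed range, and this range is dense by the density of smooth functions. -/
theorem exists_hasTrace (hn : 1 ≤ n) (hΩ : IsBoundedLipschitzDomain Ω) (u : H1 Ω) :
    ∃ t, HasTrace u t := by
  obtain ⟨C, hC⟩ := norm_le_of_mem_closure hn hΩ
  set S := (traceData hn hΩ).range.topologicalClosure with hS
  have hScl : IsClosed (S : Set (TraceTriple Ω)) :=
    Submodule.isClosed_topologicalClosure _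
  have := hScl.completeSpace_coe
  let π : S →L[ℂ] Lp ℂ 2 (vol Ω) × Lp (Cn n) 2 (vol Ω) :=
    (ContinuousLinearMap.fst ℂ _ _).comp S.subtypeL
  have hanti : AntilipschitzWith (1 + C) π := by
    refine π.antilipschitz_of_bound fun x => ?_
    have h1 := hC x x.2
    change ‖(x : TraceTriple Ω)‖ ≤ ((1 + C : ℝ≥0) : ℝ) * ‖(x : TraceTriple Ω).1‖
    rw [NNReal.coe_add, NNReal.coe_one, add_mul, one_mul, Prod.norm_def]
    exact max_le (le_add_of_nonneg_right (by positivity))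
      (h1.trans (le_add_of_nonneg_left (norm_nonneg _)))
  have hrange : IsClosed (Set.range π) := hanti.isClosed_range π.uniformContinuous
  have hmem : (fn u, grad u) ∈ Set.range π := by
    rw [← hrange.closure_eq, Metric.mem_closure_iff]
    intro ε hε
    obtain ⟨φ, hφ, h1, h2⟩ := hΩ.exists_smooth_approx u
      (ENNReal.ofReal_pos.2 (half_pos hε)).ne'
    refine ⟨_, ⟨⟨traceData hn hΩ ⟨φ, hφ⟩, subset_closure ⟨_, rfl⟩⟩, rfl⟩, ?_⟩
    rw [dist_comm, ← edist_lt_ofReal]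
    refine lt_of_le_of_lt ?_ (ENNReal.ofReal_lt_ofReal_iff hε |>.2 (half_lt_self hε))
    have m1 := memLp_vol_of_continuous hΩ.isBounded hφ.continuous
    have m2 := memLp_vol_of_continuous hΩ.isBounded (continuous_gradVec hφ)
    refine max_le ?_ ?_
    · refine le_trans (le_of_eq ?_) h1
      have h := Lp.edist_toLp_toLp _ _ m1 (Lp.memLp (fn u))
      rw [Lp.toLp_coeFn] at h
      exact h
    · refine le_trans (le_of_eq ?_) h2
      have h := Lp.edist_toLp_toLp _ _ m2 (Lp.memLp (grad u))
      rw [Lp.toLp_coeFn] at h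
      exact h
  obtain ⟨x, hx⟩ := hmem
  refine ⟨(x : TraceTriple Ω).2, (hasTrace_iff hn hΩ u _).2 ?_⟩
  rw [← hx]
  exact x.2

theorem HasTrace.norm_le (hn : 1 ≤ n) (hΩ : IsBoundedLipschitzDomain Ω) :
    ∃ C : ℝ≥0, ∀ (u : H1 Ω) (t : Lp ℂ 2 (surf Ω)), HasTrace u t → ‖t‖ ≤ C * ‖u‖ := by
  obtain ⟨C, hC⟩ := norm_le_of_mem_closure hn hΩ
  refine ⟨C, fun u t h => (hC _ ((hasTrace_iff hn hΩ u t).1 h)).trans ?_⟩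
  refine mul_le_mul_of_nonneg_left (max_le ?_ ?_) C.2
  · exact WithLp.norm_fst_le _ (u : L2Pair Ω)
  · exact WithLp.norm_snd_le _ (u : L2Pair Ω)

theorem HasTrace.unique (hn : 1 ≤ n) (hΩ : IsBoundedLipschitzDomain Ω) {u : H1 Ω}
    {t t' : Lp ℂ 2 (surf Ω)} (h : HasTrace u t) (h' : HasTrace u t') : t = t' := by
  obtain ⟨C, hC⟩ := norm_le_of_mem_closure hn hΩ
  have h1 := hC _ (Submodule.sub_mem _ ((hasTrace_iff hn hΩ u t).1 h)
    ((hasTrace_iff hn hΩ u t').1 h'))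
  simpa [sub_eq_zero] using h1

theorem hasTrace_trace (hn : 1 ≤ n) (hΩ : IsBoundedLipschitzDomain Ω) (u : H1 Ω) :
    HasTrace u (trace u) := by
  have h := exists_hasTrace hn hΩ u
  rw [trace, dif_pos h]
  exact h.choose_spec

/-- The trace is a bounded linear operator on `H¹(Ω)`. -/
theorem exists_trace_eq_continuousLinearMap (hn : 1 ≤ n) (hΩ : IsBoundedLipschitzDomain Ω) :
    ∃ Tr : H1 Ω →L[ℂ] Lp ℂ 2 (surf Ω), ∀ u, trace u = Tr u := by
  obtain ⟨C, hC⟩ := HasTrace.norm_le hn hΩ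
  have hmem := fun u => (hasTrace_iff hn hΩ u _).1 (hasTrace_trace hn hΩ u)
  let L : H1 Ω →ₗ[ℂ] Lp ℂ 2 (surf Ω) :=
    { toFun := trace
      map_add' := fun u v => (hasTrace_trace hn hΩ (u + v)).unique hn hΩ
        ((hasTrace_iff hn hΩ _ _).2 (Submodule.add_mem _ (hmem u) (hmem v)))
      map_smul' := fun c u => (hasTrace_trace hn hΩ (c • u)).unique hn hΩ
        ((hasTrace_iff hn hΩ _ _).2 (Submodule.smul_mem _ c (hmem u))) }
  exact ⟨L.mkContinuous C fun u => hC u _ (hasTrace_trace hn hΩ u), fun u => rfl⟩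

theorem trace_eq_of_const (hn : 1 ≤ n) (hΩ : IsBoundedLipschitzDomain Ω) {u : H1 Ω} {c : ℂ}
    (hu : ∀ᵐ x ∂(vol Ω), fn u x = c) (hg : grad u = 0) : ∀ᵐ x ∂(surf Ω), trace u x = c := by
  have hm := memLp_surf hn hΩ (φ := fun _ => c) contDiff_const
  have h : HasTrace u (hm.toLp _) := by
    refine (hasTrace_iff hn hΩ u _).2 (Submodule.le_topologicalClosure _
      ⟨⟨fun _ => c, (contDiff_const : ContDiff ℝ (⊤ : ℕ∞) fun _ : Rn n => c)⟩, Prod.ext (Prod.ext ?_ ?_) rfl⟩)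
    · refine Lp.ext ?_
      filter_upwards [hu, (memLp_vol_of_continuous hΩ.isBounded
        (continuous_const (y := c))).coeFn_toLp] with x hx h1
      exact h1.trans hx.symm
    · rw [hg]
      have h0 : gradVec (fun _ : Rn n => c) = fun _ => 0 := by
        ext x i
        simp [gradVec, partialDeriv]
      have hm0 : MemLp (gradVec fun _ : Rn n => c) 2 (vol Ω) := by rw [h0]; exact MemLp.zero
      refine Lp.ext ?_
      filter_upwards [Lp.coeFn_zero (Cn n) 2 (vol Ω), hm0.coeFn_toLp] with x h1 h2
      exact h2.trans (by rw [h0, h1]; rfl)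
  rw [(hasTrace_trace hn hΩ u).unique hn hΩ h]
  exact hm.coeFn_toLp

end

/-! ### The Hilbert space `ℋ¹` and the operators of the forms `B_{σ,ζ}` -/

section

variable {n M : ℕ} {Ω : Set (Rn n)}

/-- `H¹(Ω)` is closed in `L²(Ω) × L²(Ω)ⁿ`, since weak gradients are stable under `L²` limits. -/
theorem isClosed_H1 (Ω : Set (Rn n)) : IsClosed (H1 Ω : Set (L2Pair Ω)) := by
  refine isClosed_of_closure_subset fun p hp φ hφ hs hsub i => ?_
  -- both sides of the defining identity are inner products with fixed `L²` functions
  have m1 : MemLp (fun x => ((partialDeriv φ i x : ℝ) : ℂ)) 2 (vol Ω) :=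
    ((continuous_partialDeriv hφ i).memLp_of_hasCompactSupport
      (hasCompactSupport_partialDeriv hs i)).ofReal
  have m2 : MemLp (fun x => (EuclideanSpace.single i ((φ x : ℝ) : ℂ) : Cn n)) 2 (vol Ω) := by
    have hc : Continuous fun x => (EuclideanSpace.single i ((φ x : ℝ) : ℂ) : Cn n) :=
      (PiLp.continuous_toLp 2 _).comp ((continuous_single i).comp
        (Complex.continuous_ofReal.comp hφ.continuous))
    exact hc.memLp_of_hasCompactSupport
      (hs.comp_left (g := fun r : ℝ => (EuclideanSpace.single i (r : ℂ) : Cn n)) (by simp))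
  have e1 : ∀ q : L2Pair Ω, ∫ x in Ω, partialDeriv φ i x • q.fst x = inner ℂ (m1.toLp _) q.fst := by
    intro q
    rw [L2.inner_def]
    refine integral_congr_ae ?_
    filter_upwards [m1.coeFn_toLp] with x hx
    rw [hx]
    simp [mul_comm]
  have e2 : ∀ q : L2Pair Ω, ∫ x in Ω, φ x • q.snd x i = inner ℂ (m2.toLp _) q.snd := by
    intro q
    rw [L2.inner_def]
    refine integral_congr_ae ?_
    filter_upwards [m2.coeFn_toLp] with x hx
    rw [hx, EuclideanSpace.inner_single_left]
    simp
  have hcl : IsClosed {q : L2Pair Ω | inner ℂ (m1.toLp _) q.fst = -inner ℂ (m2.toLp _) q.snd} :=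
    isClosed_eq (continuous_const.inner (WithLp.continuous_fst 2 _ _))
      (continuous_const.inner (WithLp.continuous_snd 2 _ _)).neg
  rw [e1, e2]
  refine closure_minimal (fun q hq => ?_) hcl hp
  have h := hq φ hφ hs hsub i
  rwa [e1, e2] at h

instance : CompleteSpace (H1 Ω) := (isClosed_H1 Ω).completeSpace_coe

theorem finiteDimensional_constPairs [NeZero M] : FiniteDimensional ℂ (constPairs Ω M) := by
  let L : HSum Ω M →ₗ[ℂ] ℂ :=
    (EuclideanSpace.proj (𝕜 := ℂ) (0 : Fin M) : Cn M →L[ℂ] ℂ).toLinearMap ∘ₗ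
      (WithLp.sndL 2 ℂ (H1 Ω) (Cn M)).toLinearMap
  refine FiniteDimensional.of_injective (L ∘ₗ (constPairs Ω M).subtype) ?_
  rw [injective_iff_map_eq_zero]
  rintro ⟨p, c, h1, h2, h3⟩ hp
  have hc : c = 0 := (h3 0).symm.trans hp
  subst hc
  refine Subtype.ext (WithLp.ofLp_injective 2 (Prod.ext (Subtype.ext
    (WithLp.ofLp_injective 2 (Prod.ext ?_ h2))) ?_))
  · refine Lp.ext ?_
    filter_upwards [h1, Lp.coeFn_zero ℂ 2 (vol Ω)] with x hx h0
    exact hx.trans h0.symm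
  · ext m
    exact h3 m

instance [NeZero M] : (constPairs Ω M).HasOrthogonalProjection :=
  have := finiteDimensional_constPairs (Ω := Ω) (M := M)
  have : T2Space (HSum Ω M) :=
    @TopologicalSpace.t2Space_of_metrizableSpace _ _ EMetricSpace.metrizableSpace
  have : T2Space (constPairs Ω M) := instT2SpaceSubtype
  have : CompleteSpace (constPairs Ω M) := FiniteDimensional.complete ℂ _
  inferInstance

/-- The orthogonal complement of the constant pairs in `H¹(Ω) ⊕ ℂ^M`: a concrete model of the
Hilbert space `ℋ¹`. -/
def HPerp (Ω : Set (Rn n)) (M : ℕ) : Type := (constPairs Ω M)ᗮ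

noncomputable instance : NormedAddCommGroup (HPerp Ω M) :=
  Submodule.normedAddCommGroup (constPairs Ω M)ᗮ

noncomputable instance : InnerProductSpace ℂ (HPerp Ω M) :=
  Submodule.innerProductSpace (constPairs Ω M)ᗮ

-- a shortcut: instance search would otherwise find the inner product of a Hilbert C⋆-module
noncomputable instance : Inner ℂ (HPerp Ω M) := InnerProductSpace.toInner

instance : CompleteSpace (HPerp Ω M) := Submodule.instOrthogonalCompleteSpace (constPairs Ω M)

/-- The inclusion of the orthogonal complement of the constant pairs. -/
noncomputable def incl (Ω : Set (Rn n)) (M : ℕ) : HPerp Ω M →L[ℂ] HSum Ω M :=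
  (constPairs Ω M)ᗮ.subtypeL

/-- The orthogonal projection onto the complement of the constant pairs. -/
noncomputable def proj (Ω : Set (Rn n)) (M : ℕ) [NeZero M] : HSum Ω M →L[ℂ] HPerp Ω M :=
  (constPairs Ω M)ᗮ.orthogonalProjectionOnto

theorem sub_proj_mem [NeZero M] (p : HSum Ω M) : p - incl Ω M (proj Ω M p) ∈ constPairs Ω M := by
  have h : incl Ω M (proj Ω M p) = p - (constPairs Ω M).starProjection p :=
    (Submodule.coe_orthogonalProjectionOnto_apply _ _).trans
      (by rw [Submodule.starProjection_orthogonal]; rfl)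
  rw [h, sub_sub_cancel]
  exact Submodule.starProjection_apply_mem _ _

theorem proj_incl [NeZero M] (x : HPerp Ω M) : proj Ω M (incl Ω M x) = x :=
  Submodule.orthogonalProjectionOnto_mem_subspace_eq_self (K := (constPairs Ω M)ᗮ) x

theorem cls_eq_iff {p q : HSum Ω M} : HQuot.cls p = HQuot.cls q ↔ p - q ∈ constPairs Ω M :=
  Submodule.Quotient.eq _

theorem cls_incl_proj [NeZero M] (p : HSum Ω M) :
    HQuot.cls (incl Ω M (proj Ω M p)) = HQuot.cls p :=
  (cls_eq_iff.2 (sub_proj_mem p)).symm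

theorem norm_cls [NeZero M] (p : HSum Ω M) : ‖HQuot.cls p‖ = ‖proj Ω M p‖ := by
  have h := (constPairs Ω M).quotientEquivOrthogonal.norm_map (HQuot.cls p)
  rw [← h, ← cls_incl_proj]
  exact congrArg norm ((constPairs Ω M).quotientEquivOrthogonal_mk _ (proj Ω M p).2)

theorem cls_eq_iff_proj_eq [NeZero M] {p q : HSum Ω M} :
    HQuot.cls p = HQuot.cls q ↔ proj Ω M p = proj Ω M q := by
  refine ⟨fun h => ?_, fun h => by rw [← cls_incl_proj p, ← cls_incl_proj q, h]⟩
  have h0 : HQuot.cls (p - q) = 0 := (Submodule.Quotient.mk_eq_zero _).2 (cls_eq_iff.1 h)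
  have h1 : ‖proj Ω M (p - q)‖ = 0 :=
    (norm_cls _).symm.trans ((congrArg norm h0).trans norm_zero)
  rw [← sub_eq_zero, ← map_sub]
  exact norm_eq_zero.1 h1

/-- The pair `(0, I)`, which for `I ∈ ℂ^M_⋄` represents the right-hand side `I · V̄`. -/
noncomputable def currentPair (Ω : Set (Rn n)) (I : Cn M) : HSum Ω M := WithLp.toLp 2 (0, I)

theorem currentPair_mem (I : diamond M) : currentPair Ω (I : Cn M) ∈ (constPairs Ω M)ᗮ := by
  rintro p ⟨c, -, -, h⟩
  have hI : ∑ m, (I : Cn M) m = 0 := I.2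
  change inner ℂ p.fst 0 + inner ℂ p.snd (I : Cn M) = 0
  rw [inner_zero_right, zero_add, PiLp.inner_apply]
  simp [h, ← Finset.sum_mul, hI]

/-- The representative in `ℋ¹` of the functional `(v, V) ↦ I · V̄`. -/
noncomputable def current (Ω : Set (Rn n)) (I : diamond M) : HPerp Ω M :=
  ⟨currentPair Ω I, currentPair_mem I⟩

theorem norm_current (I : diamond M) : ‖current Ω I‖ = ‖I‖ := by
  change ‖currentPair Ω (I : Cn M)‖ = ‖(I : Cn M)‖
  simp [currentPair]

theorem current_add (I J : diamond M) : current Ω (I + J) = current Ω I + current Ω J :=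
  Subtype.ext (WithLp.ofLp_injective 2 (Prod.ext (add_zero _).symm rfl))

theorem inner_proj_current [NeZero M] (q : HSum Ω M) (I : diamond M) :
    inner ℂ (proj Ω M q) (current Ω I) = ∑ m, (I : Cn M) m * starRingEnd ℂ (q.snd m) := by
  refine (Submodule.inner_orthogonalProjectionOnto_eq_of_mem_right (K := (constPairs Ω M)ᗮ)
    ⟨currentPair Ω I, currentPair_mem I⟩ q).trans ?_
  change inner ℂ q.fst 0 + inner ℂ q.snd (I : Cn M) = _
  simp [PiLp.inner_apply]

/-- Multiplication of `L²` functions by `L^∞` functions, as a bounded bilinear map. -/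
noncomputable def mulL {α : Type*} [MeasurableSpace α] (μ : Measure α) (F : Type*)
    [NormedAddCommGroup F] [NormedSpace ℂ F] : Lp ℂ ∞ μ →L[ℂ] Lp F 2 μ →L[ℂ] Lp F 2 μ :=
  (ContinuousLinearMap.lsmul ℂ ℂ).holderL μ ∞ 2 2

theorem coeFn_mulL {α : Type*} [MeasurableSpace α] {μ : Measure α} {F : Type*}
    [NormedAddCommGroup F] [NormedSpace ℂ F] (f : Lp ℂ ∞ μ) (g : Lp F 2 μ) :
    mulL μ F f g =ᵐ[μ] fun x => f x • g x :=
  ContinuousLinearMap.coeFn_holder (ContinuousLinearMap.lsmul ℂ ℂ) f g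

variable {E : Fin M → Set (Rn n)}

theorem measurableSet_electrode (hE : IsExtendedElectrodes Ω E) (m : Fin M) :
    MeasurableSet (E m) := by
  obtain ⟨O, hO, h⟩ := hE.relOpen m
  rw [h]
  exact hO.measurableSet.inter isClosed_frontier.measurableSet

theorem memLp_pwConst (hn : 1 ≤ n) (hΩ : IsBoundedLipschitzDomain Ω)
    (hE : IsExtendedElectrodes Ω E) (V : Cn M) : MemLp (pwConst E V) 2 (surf Ω) := by
  have := isFiniteMeasure_surf hn hΩ
  exact memLp_finsetSum _ fun m _ => (memLp_const (V m)).indicator (measurableSet_electrode hE m)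

theorem pwConst_const (hE : IsExtendedElectrodes Ω E) {V : Cn M} {c : ℂ} (hV : ∀ m, V m = c)
    {x : Rn n} (hx : x ∈ ⋃ m, E m) : pwConst E V x = c := by
  obtain ⟨m, hm⟩ := mem_iUnion.1 hx
  rw [pwConst, Finset.sum_eq_single m, indicator_of_mem hm, hV]
  · intro l _ hl
    exact indicator_of_notMem (fun h => (hE.disjoint hl).le_bot ⟨h, hm⟩) _
  · simp

/-- The map `(v, V) ↦ χ_E (V - v)` into `L²(∂Ω)`, where `E` is the union of the electrodes. -/
theorem exists_electrodeJump (hn : 1 ≤ n) (hΩ : IsBoundedLipschitzDomain Ω)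
    (hE : IsExtendedElectrodes Ω E) :
    ∃ T : HSum Ω M →L[ℂ] Lp ℂ 2 (surf Ω), ∀ p, ∀ᵐ x ∂(surf Ω),
      T p x = (⋃ m, E m).indicator (fun x => pwConst E p.snd x - trace p.fst x) x := by
  have := isFiniteMeasure_surf hn hΩ
  obtain ⟨Tr, hTr⟩ := exists_trace_eq_continuousLinearMap hn hΩ
  have hEm : MeasurableSet (⋃ m, E m) := MeasurableSet.iUnion (measurableSet_electrode hE)
  let W : Cn M →ₗ[ℂ] Lp ℂ 2 (surf Ω) :=
    { toFun := fun V => (memLp_pwConst hn hΩ hE V).toLp _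
      map_add' := fun V V' => by
        rw [← MemLp.toLp_add]
        refine MemLp.toLp_congr _ _ (Eventually.of_forall fun x => ?_)
        simp only [pwConst, Pi.add_apply, ← Finset.sum_add_distrib]
        exact Finset.sum_congr rfl fun m _ => by by_cases h : x ∈ E m <;> simp [h]
      map_smul' := fun c V => by
        rw [RingHom.id_apply, ← MemLp.toLp_const_smul]
        refine MemLp.toLp_congr _ _ (Eventually.of_forall fun x => ?_)
        simp only [pwConst, Pi.smul_apply, Finset.smul_sum]
        exact Finset.sum_congr rfl fun m _ => by by_cases h : x ∈ E m <;> simp [h] }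
  let χ : Lp ℂ ∞ (surf Ω) := indicatorConstLp ∞ hEm (measure_ne_top _ _) 1
  refine ⟨(mulL (surf Ω) ℂ χ).comp (W.toContinuousLinearMap.comp (WithLp.sndL 2 ℂ _ _) -
    Tr.comp (WithLp.fstL 2 ℂ _ _)), fun p => ?_⟩
  have h1 := coeFn_mulL χ (W p.snd - Tr p.fst)
  filter_upwards [h1, Lp.coeFn_sub (W p.snd) (Tr p.fst), (memLp_pwConst hn hΩ hE p.snd).coeFn_toLp,
    (indicatorConstLp_coeFn : χ =ᵐ[surf Ω] _)] with x h1 h2 h3 h4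
  refine h1.trans ?_
  rw [h2, h4, Pi.sub_apply, hTr]
  change _ • ((memLp_pwConst hn hΩ hE p.snd).toLp _ x - _) = _
  rw [h3]
  by_cases hx : x ∈ ⋃ m, E m <;> simp [hx]

theorem form_eq_inner {σ : Lp ℂ ∞ (vol Ω)} {ζ : Lp ℂ ∞ (surf Ω)} (hζ : ζ ∈ LinfE Ω E)
    {T : HSum Ω M →L[ℂ] Lp ℂ 2 (surf Ω)} (hT : ∀ p, ∀ᵐ x ∂(surf Ω),
      T p x = (⋃ m, E m).indicator (fun x => pwConst E p.snd x - trace p.fst x) x)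
    (p q : HSum Ω M) : form E σ ζ p q =
      inner ℂ (grad q.fst) (mulL (vol Ω) (Cn n) σ (grad p.fst)) +
        inner ℂ (T q) (mulL (surf Ω) ℂ ζ (T p)) := by
  rw [form, L2.inner_def, L2.inner_def]
  congr 1
  · refine integral_congr_ae ?_
    filter_upwards [coeFn_mulL σ (grad p.fst)] with x hx
    rw [hx, inner_smul_right, PiLp.inner_apply]
    simp
  · refine integral_congr_ae ?_
    filter_upwards [coeFn_mulL ζ (T p), hT p, hT q, hζ] with x h1 h2 h3 h4
    rw [h1, h2, h3]
    by_cases hx : x ∈ ⋃ m, E m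
    · simp [hx, mul_assoc]
    · simp [hx, h4 hx]

/-- The operators on `ℋ¹` representing the forms `B_{σ,ζ}`; they depend additively and boundedly
on the parameters. -/
theorem exists_forwardOperator [NeZero M] (hn : 1 ≤ n) (hΩ : IsBoundedLipschitzDomain Ω)
    (hE : IsExtendedElectrodes Ω E) :
    ∃ (A : Lp ℂ ∞ (vol Ω) → Lp ℂ ∞ (surf Ω) → HPerp Ω M →L[ℂ] HPerp Ω M) (C : ℝ),
      0 ≤ C ∧ (∀ σ ω ζ η, A (σ + ω) (ζ + η) = A σ ζ + A ω η) ∧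
      (∀ ω η, ‖A ω η‖ ≤ C * max ‖ω‖ ‖η‖) ∧
      ∀ σ, ∀ ζ ∈ LinfE Ω E, ∀ p q : HSum Ω M,
        form E σ ζ p q = inner ℂ (proj Ω M q) (A σ ζ (proj Ω M p)) := by
  obtain ⟨T, hT⟩ := exists_electrodeJump (M := M) hn hΩ hE
  let G : HSum Ω M →L[ℂ] Lp (Cn n) 2 (vol Ω) :=
    (WithLp.sndL 2 ℂ _ _).comp ((H1 Ω).subtypeL.comp (WithLp.fstL 2 ℂ _ _))
  have hG0 : ∀ p ∈ constPairs Ω M, G p = 0 := fun p ⟨c, _, h, _⟩ => h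
  have hT0 : ∀ p ∈ constPairs Ω M, T p = 0 := by
    rintro p ⟨c, h1, h2, h3⟩
    refine Lp.ext ?_
    filter_upwards [hT p, trace_eq_of_const hn hΩ h1 h2, Lp.coeFn_zero ℂ 2 (surf Ω)] with x k1 k2 k3
    rw [k1, k3]
    by_cases hx : x ∈ ⋃ m, E m
    · simp only [indicator_of_mem hx, k2, pwConst_const hE h3 hx, sub_self, Pi.zero_apply]
    · simp only [indicator_of_notMem hx, Pi.zero_apply]
  have hGp : ∀ p, G (incl Ω M (proj Ω M p)) = G p := fun p =>
    (sub_eq_zero.1 ((map_sub G _ _).symm.trans (hG0 _ (sub_proj_mem p)))).symm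
  have hTp : ∀ p, T (incl Ω M (proj Ω M p)) = T p := fun p =>
    (sub_eq_zero.1 ((map_sub T _ _).symm.trans (hT0 _ (sub_proj_mem p)))).symm
  let G' := G.comp (incl Ω M)
  let T' := T.comp (incl Ω M)
  let L₁ := mulL (vol Ω) (Cn n)
  let L₂ := mulL (surf Ω) ℂ
  refine ⟨fun σ ζ => (ContinuousLinearMap.adjoint G').comp ((L₁ σ).comp G') +
    (ContinuousLinearMap.adjoint T').comp ((L₂ ζ).comp T'),
    ‖G'‖ * (‖L₁‖ * ‖G'‖) + ‖T'‖ * (‖L₂‖ * ‖T'‖), by positivity, ?_, ?_, ?_⟩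
  · intro σ ω ζ η
    ext1 x
    simp only [map_add, add_apply, ContinuousLinearMap.comp_apply]
    abel
  · intro ω η
    have bound : ∀ {F : Type} [NormedAddCommGroup F] [InnerProductSpace ℂ F] [CompleteSpace F]
        (S : HPerp Ω M →L[ℂ] F) (N : F →L[ℂ] F) (c d : ℝ), ‖N‖ ≤ c * d →
        ‖(ContinuousLinearMap.adjoint S).comp (N.comp S)‖ ≤ ‖S‖ * (c * ‖S‖) * d := by
      intro F _ _ _ S N c d hN
      refine (ContinuousLinearMap.opNorm_comp_le _ _).trans ?_
      rw [LinearIsometryEquiv.norm_map]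
      calc ‖S‖ * ‖N.comp S‖ ≤ ‖S‖ * (‖N‖ * ‖S‖) := by
            gcongr; exact ContinuousLinearMap.opNorm_comp_le _ _
        _ ≤ ‖S‖ * (c * d * ‖S‖) := by gcongr
        _ = _ := by ring
    refine (norm_add_le _ _).trans ?_
    rw [add_mul]
    refine add_le_add (bound G' _ _ _ ?_) (bound T' _ _ _ ?_)
    · exact (L₁.le_opNorm ω).trans (by gcongr; exact le_max_left _ _)
    · exact (L₂.le_opNorm η).trans (by gcongr; exact le_max_right _ _)
  · intro σ ζ hζ p q
    rw [form_eq_inner hζ hT, add_apply, inner_add_right]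
    refine congrArg₂ (· + ·)
      (.trans ?_ (ContinuousLinearMap.adjoint_inner_right G' _ (L₁ σ (G' _))).symm)
      (.trans ?_ (ContinuousLinearMap.adjoint_inner_right T' _ (L₂ ζ (T' _))).symm)
    · simp only [G', ContinuousLinearMap.comp_apply, hGp]
      rfl
    · simp only [T', ContinuousLinearMap.comp_apply, hTp]
      rfl

end

/-! ### Stability, the zero-mean normalization and admissible perturbations -/

/-- Stability of coercive problems: a perturbation `B` of the operator and `g` of the right-hand
side moves the solution by at most a multiple of `‖g‖ + ‖B‖ ‖f‖`. -/
theorem norm_sub_le_of_coercive {H : Type*} [NormedAddCommGroup H] [InnerProductSpace ℂ H]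
    [CompleteSpace H] {A B : H →L[ℂ] H} {c : ℝ} (hc : 0 < c)
    (hA : ∀ x, c * ‖x‖ ^ 2 ≤ (inner ℂ x (A x)).re) (hB : ‖B‖ ≤ c / 2) :
    Function.Bijective (A + B) ∧ ∀ x x' f g, A x = f → (A + B) x' = f + g →
      ‖x' - x‖ ≤ 2 / c * (‖g‖ + ‖B‖ * (‖f‖ / c)) := by
  have hAB : ∀ x, c / 2 * ‖x‖ ^ 2 ≤ (inner ℂ x ((A + B) x)).re := by
    intro x
    have h1 : -(inner ℂ x (B x)).re ≤ c / 2 * ‖x‖ ^ 2 :=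
      calc -(inner ℂ x (B x)).re ≤ ‖inner ℂ x (B x)‖ :=
            (neg_le_abs _).trans (Complex.abs_re_le_norm _)
        _ ≤ ‖x‖ * ‖B x‖ := norm_inner_le_norm _ _
        _ ≤ ‖x‖ * (c / 2 * ‖x‖) := by gcongr; exact B.le_of_opNorm_le hB x
        _ = c / 2 * ‖x‖ ^ 2 := by ring
    have h2 := hA x
    rw [add_apply, inner_add_right, Complex.add_re]
    linarith
  obtain ⟨h1, -⟩ := bijective_of_coercive A hc hA
  obtain ⟨h2, h3⟩ := bijective_of_coercive (A + B) (half_pos hc) hAB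
  refine ⟨h3, ?_⟩
  rintro x x' f g rfl hx'
  have h4 : (A + B) (x' - x) = g - B x := by
    rw [map_sub, hx', add_apply]
    abel
  have h5 := h2 (x' - x)
  rw [h4] at h5
  have h6 : ‖x‖ ≤ ‖A x‖ / c := by
    rw [le_div_iff₀ hc, mul_comm]
    exact h1 x
  have h7 : ‖g - B x‖ ≤ ‖g‖ + ‖B‖ * (‖A x‖ / c) :=
    (norm_sub_le _ _).trans (add_le_add le_rfl ((B.le_opNorm x).trans (by gcongr)))
  rw [div_mul_eq_mul_div, le_div_iff₀ hc]
  linarith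

section

variable {n M : ℕ} {Ω : Set (Rn n)} {E : Fin M → Set (Rn n)}

/-- The constant functions belong to `H¹(Ω)`, with vanishing weak gradient. -/
theorem exists_const_H1 (hΩ : IsBoundedLipschitzDomain Ω) (c : ℂ) :
    ∃ u : H1 Ω, (∀ᵐ x ∂(vol Ω), fn u x = c) ∧ grad u = 0 := by
  have : IsFiniteMeasure (vol Ω) := ⟨by simpa using hΩ.isBounded.measure_lt_top⟩
  have hc : MemLp (fun _ => c) 2 (vol Ω) := memLp_const c
  refine ⟨⟨WithLp.toLp 2 (hc.toLp _, 0), fun φ hφ hs hsub i => ?_⟩, hc.coeFn_toLp, rfl⟩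
  have e1 : ∫ x in Ω, partialDeriv φ i x • (hc.toLp _ : Rn n → ℂ) x = 0 := by
    have h0 : ∫ x in Ω, partialDeriv φ i x = 0 := by
      rw [setIntegral_eq_integral_of_forall_compl_eq_zero]
      · have hi1 := (continuous_partialDeriv hφ i).integrable_of_hasCompactSupport (μ := volume)
          (hasCompactSupport_partialDeriv hs i)
        have hi2 := hφ.continuous.integrable_of_hasCompactSupport (μ := volume) hs
        have h := integral_mul_fderiv_eq_neg_fderiv_mul_of_integrable (𝕜 := ℝ) (μ := volume)
          (f := fun _ : Rn n => (1 : ℝ)) (g := φ) (v := EuclideanSpace.single i 1)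
          (by simp) (by simp only [one_mul]; exact hi1) (by simpa using hi2)
          (fun _ _ => differentiableAt_const _) (fun x _ => hφ.differentiable (by simp) x)
        simpa [partialDeriv] using h
      · intro x hx
        have h : x ∉ tsupport φ := fun h => hx (hsub h)
        rw [partialDeriv, fderiv_of_notMem_tsupport ℝ h]
        rfl
    calc ∫ x in Ω, partialDeriv φ i x • (hc.toLp _ : Rn n → ℂ) x
        = ∫ x in Ω, partialDeriv φ i x • c := by
          refine integral_congr_ae ?_
          filter_upwards [hc.coeFn_toLp] with x hx
          rw [hx]
      _ = 0 := by rw [integral_smul_const, h0, zero_smul]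
  have e2 : ∫ x in Ω, φ x • (0 : Lp (Cn n) 2 (vol Ω)) x i = 0 := by
    refine (integral_congr_ae ?_).trans (integral_zero _ _)
    filter_upwards [Lp.coeFn_zero (Cn n) 2 (vol Ω)] with x hx
    rw [hx, Pi.zero_apply, PiLp.zero_apply, smul_zero]
  refine e1.trans ?_
  rw [zero_eq_neg]
  exact e2

/-- Every class in `ℋ¹` has a representative whose electrode component has zero mean, and that
component is unique. -/
theorem existsUnique_zeroMean [NeZero M] (hΩ : IsBoundedLipschitzDomain Ω) (s : HQuot Ω M) :
    ∃! U : diamond M, ∃ u : H1 Ω, HQuot.cls (WithLp.toLp 2 (u, (U : Cn M))) = s := by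
  have hM : (M : ℂ) ≠ 0 := Nat.cast_ne_zero.2 (NeZero.ne M)
  obtain ⟨p, rfl⟩ := (constPairs Ω M).mkQ_surjective s
  change ∃! U : diamond M, ∃ u : H1 Ω, HQuot.cls (WithLp.toLp 2 (u, (U : Cn M))) = HQuot.cls p
  obtain ⟨k, hk1, hk2⟩ := exists_const_H1 hΩ (-((∑ m, p.snd m) / M))
  have hU : ∑ m, (WithLp.toLp 2 fun m => p.snd m - (∑ m, p.snd m) / M : Cn M) m = 0 := by
    simp [Finset.sum_sub_distrib, mul_div_cancel₀ _ hM]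
  refine ⟨⟨_, hU⟩, ⟨p.fst + k, cls_eq_iff.2 ⟨-((∑ m, p.snd m) / M), ?_, ?_, ?_⟩⟩, ?_⟩
  · have h : (WithLp.toLp 2 (p.fst + k, (WithLp.toLp 2 fun m => p.snd m - (∑ m, p.snd m) / M
      : Cn M)) - p : HSum Ω M).fst = k := add_sub_cancel_left p.fst k
    rw [h]
    exact hk1
  · have h : (WithLp.toLp 2 (p.fst + k, (WithLp.toLp 2 fun m => p.snd m - (∑ m, p.snd m) / M
      : Cn M)) - p : HSum Ω M).fst = k := add_sub_cancel_left p.fst k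
    rw [h]
    exact hk2
  · intro m
    change p.snd m - (∑ m, p.snd m) / M - p.snd m = _
    ring
  · rintro V ⟨v, hv⟩
    obtain ⟨c, -, -, hc⟩ := cls_eq_iff.1 hv
    have hV : ∑ m, (V : Cn M) m = 0 := V.2
    have hc' : ∀ m, (V : Cn M) m - p.snd m = c := hc
    have h1 : -∑ m, p.snd m = M * c := by
      have := Finset.sum_congr (rfl : Finset.univ = Finset.univ) fun m _ => hc' m
      simpa [Finset.sum_sub_distrib, hV] using this
    refine Subtype.ext ?_
    ext m
    change (V : Cn M) m = p.snd m - (∑ m, p.snd m) / M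
    have h2 : (∑ m, p.snd m) / M = -c := by
      rw [div_eq_iff hM]
      linear_combination -h1
    rw [h2]
    linear_combination hc' m

theorem isSolution_cls_iff [NeZero M] {σ : Lp ℂ ∞ (vol Ω)} {ζ : Lp ℂ ∞ (surf Ω)}
    {A : HPerp Ω M →L[ℂ] HPerp Ω M}
    (hA : ∀ p q : HSum Ω M, form E σ ζ p q = inner ℂ (proj Ω M q) (A (proj Ω M p)))
    (I : diamond M) (p : HSum Ω M) :
    IsSolution E σ ζ I (HQuot.cls p) ↔ A (proj Ω M p) = current Ω I := by
  refine ⟨fun h => ?_, fun h p' hp' q => ?_⟩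
  · refine ext_inner_left ℂ fun y => ?_
    have h1 := h p rfl (incl Ω M y)
    rwa [hA, ← inner_proj_current, proj_incl] at h1
  · rw [hA, cls_eq_iff_proj_eq.1 hp', h, inner_proj_current]

theorem isSolution_iff_eq [NeZero M] {σ : Lp ℂ ∞ (vol Ω)} {ζ : Lp ℂ ∞ (surf Ω)}
    {A : HPerp Ω M →L[ℂ] HPerp Ω M}
    (hA : ∀ p q : HSum Ω M, form E σ ζ p q = inner ℂ (proj Ω M q) (A (proj Ω M p)))
    (hinj : Function.Injective A) {I : diamond M} {x : HPerp Ω M} (hx : A x = current Ω I)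
    (t : HQuot Ω M) : IsSolution E σ ζ I t ↔ t = HQuot.cls (incl Ω M x) := by
  obtain ⟨p, rfl⟩ := (constPairs Ω M).mkQ_surjective t
  refine (isSolution_cls_iff hA I p).trans ?_
  refine Iff.trans ?_ cls_eq_iff_proj_eq.symm
  rw [proj_incl, ← hx, hinj.eq_iff]

theorem existsUnique_isElectrodePotential [NeZero M] (hΩ : IsBoundedLipschitzDomain Ω)
    {σ : Lp ℂ ∞ (vol Ω)} {ζ : Lp ℂ ∞ (surf Ω)} {I : diamond M} {s : HQuot Ω M}
    (hs : ∀ t, IsSolution E σ ζ I t ↔ t = s) : ∃! U : diamond M, IsElectrodePotential E σ ζ I U := by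
  simpa only [IsElectrodePotential, hs] using existsUnique_zeroMean hΩ s

theorem isElectrodePotential_measurementMap [NeZero M] (hΩ : IsBoundedLipschitzDomain Ω)
    {σ : Lp ℂ ∞ (vol Ω)} {ζ : Lp ℂ ∞ (surf Ω)} {I : diamond M} {s : HQuot Ω M}
    (hs : ∀ t, IsSolution E σ ζ I t ↔ t = s) :
    IsElectrodePotential E σ ζ I (measurementMap E σ ζ I) := by
  have h := (existsUnique_isElectrodePotential hΩ hs).exists
  rw [measurementMap, dif_pos h]
  exact h.choose_spec

theorem bddBelow_quotNorm (V : Cn M) :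
    BddBelow (range fun c : ℂ => ‖V - c • (WithLp.toLp 2 fun _ => 1 : Cn M)‖) :=
  ⟨0, by rintro _ ⟨c, rfl⟩; exact norm_nonneg _⟩

/-- The bound `‖V‖_{ℂ^M/ℂ} ≤ ‖(v, V)‖_{ℋ¹}`. -/
theorem quotNorm_le_norm_cls [NeZero M] (p : HSum Ω M) : quotNorm p.snd ≤ ‖HQuot.cls p‖ := by
  obtain ⟨c, -, -, hc⟩ := sub_proj_mem p
  have h : (incl Ω M (proj Ω M p)).snd = p.snd - c • (WithLp.toLp 2 fun _ => 1 : Cn M) := by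
    ext m
    have := hc m
    rw [WithLp.sub_snd, PiLp.sub_apply] at this
    simp [← this]
  calc quotNorm p.snd ≤ ‖p.snd - c • (WithLp.toLp 2 fun _ => 1 : Cn M)‖ :=
        ciInf_le (bddBelow_quotNorm _) c
    _ = ‖(incl Ω M (proj Ω M p)).snd‖ := by rw [h]
    _ ≤ ‖incl Ω M (proj Ω M p)‖ := WithLp.norm_snd_le _ _
    _ = ‖HQuot.cls p‖ := (norm_cls p).symm

/-- Vectors of zero mean are orthogonal to `𝟏`, so that they realize their quotient norm. -/
theorem norm_le_quotNorm (V : diamond M) : ‖V‖ ≤ quotNorm (V : Cn M) := by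
  refine le_ciInf fun c => ?_
  have hV : ∑ m, (V : Cn M) m = 0 := V.2
  have h0 : inner ℂ (V : Cn M) (-(c • (WithLp.toLp 2 fun _ => 1 : Cn M))) = 0 := by
    simp [PiLp.inner_apply, ← map_sum, ← Finset.mul_sum, hV]
  have h := norm_add_sq_eq_norm_sq_add_norm_sq_of_inner_eq_zero _ _ h0
  rw [← sub_eq_add_neg] at h
  change ‖(V : Cn M)‖ ≤ _
  nlinarith [norm_nonneg (V : Cn M), norm_nonneg ((V : Cn M) - c • (WithLp.toLp 2 fun _ => 1 : Cn M)),
    mul_self_nonneg ‖-(c • (WithLp.toLp 2 fun _ => 1 : Cn M))‖]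

theorem quotNorm_sub_le [NeZero M] {σ σ' : Lp ℂ ∞ (vol Ω)} {ζ ζ' : Lp ℂ ∞ (surf Ω)}
    {I I' U U' : diamond M} {s s' : HQuot Ω M} (hs : ∀ t, IsSolution E σ ζ I t ↔ t = s)
    (hs' : ∀ t, IsSolution E σ' ζ' I' t ↔ t = s') (hU : IsElectrodePotential E σ ζ I U)
    (hU' : IsElectrodePotential E σ' ζ' I' U') : quotNorm (U' - U : Cn M) ≤ ‖s' - s‖ := by
  obtain ⟨u, hu⟩ := hU
  obtain ⟨u', hu'⟩ := hU'
  rw [← (hs _).1 hu, ← (hs' _).1 hu']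
  exact quotNorm_le_norm_cls (WithLp.toLp 2 (u', (U' : Cn M)) - WithLp.toLp 2 (u, (U : Cn M)))

theorem add_mem_LinfE {ζ η : Lp ℂ ∞ (surf Ω)} (hζ : ζ ∈ LinfE Ω E) (hη : η ∈ LinfE Ω E) :
    ζ + η ∈ LinfE Ω E := by
  change ∀ᵐ x ∂(surf Ω), x ∉ ⋃ m, E m → (ζ + η) x = 0
  filter_upwards [hζ, hη, Lp.coeFn_add ζ η] with x h1 h2 h3 hx
  rw [h3, Pi.add_apply, h1 hx, h2 hx, add_zero]

theorem sub_mem_LinfE {ζ η : Lp ℂ ∞ (surf Ω)} (hζ : ζ ∈ LinfE Ω E) (hη : η ∈ LinfE Ω E) :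
    ζ - η ∈ LinfE Ω E := by
  change ∀ᵐ x ∂(surf Ω), x ∉ ⋃ m, E m → (ζ - η) x = 0
  filter_upwards [hζ, hη, Lp.coeFn_sub ζ η] with x h1 h2 h3 hx
  rw [h3, Pi.sub_apply, h1 hx, h2 hx, sub_zero]

end

end EIT

/-! ### The measurement map -/

theorem mainTheorem4 {n : ℕ} (hn : n = 2 ∨ n = 3) {Ω : Set (Rn n)}
    (hΩ : IsBoundedLipschitzDomain Ω) {M : ℕ} (hM : 2 ≤ M) (E : Fin M → Set (Rn n))
    (hE : IsExtendedElectrodes Ω E) :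
    -- the measurement map is well defined
    (∀ σ ∈ AdmS Ω, ∀ ζ ∈ AdmZ Ω E, ∀ I : diamond M,
      (∃! s : HQuot Ω M, IsSolution E σ ζ I s) ∧
      (∃! U : diamond M, IsElectrodePotential E σ ζ I U) ∧
      IsElectrodePotential E σ ζ I (measurementMap E σ ζ I)) ∧
    -- it is continuous on 𝒮 × 𝒵' × ℂ^M_⋄
    Continuous (fun p : AdmS Ω × AdmZ Ω E × diamond M =>
      measurementMap E (p.1 : Lp ℂ ∞ (vol Ω)) (p.2.1 : Lp ℂ ∞ (surf Ω)) p.2.2) ∧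
    -- the perturbation estimate
    (∀ σ ∈ AdmS Ω, ∀ ζ ∈ AdmZ Ω E, ∃ δ : ℝ, 0 < δ ∧ ∃ C : ℝ, 0 < C ∧
      ∀ ω : Lp ℂ ∞ (vol Ω), ‖ω‖ ≤ δ → ∀ η ∈ LinfE Ω E, ‖η‖ ≤ δ → ∀ I J : diamond M,
        ∃ s s' : HQuot Ω M,
          (∀ t, IsSolution E σ ζ I t ↔ t = s) ∧
          (∀ t, IsSolution E (σ + ω) (ζ + η) (I + J) t ↔ t = s') ∧
          IsElectrodePotential E (σ + ω) (ζ + η) (I + J)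
            (measurementMap E (σ + ω) (ζ + η) (I + J)) ∧
          quotNorm (measurementMap E (σ + ω) (ζ + η) (I + J) - measurementMap E σ ζ I : Cn M)
            ≤ ‖s' - s‖ ∧
          ‖s' - s‖ ≤ C * (‖J‖ + max ‖ω‖ ‖η‖ * ‖I‖) ∧
          ‖measurementMap E (σ + ω) (ζ + η) (I + J) - measurementMap E σ ζ I‖
            ≤ C * (‖J‖ + max ‖ω‖ ‖η‖ * ‖I‖)) := by
  have hn1 : 1 ≤ n := by omega
  have : NeZero M := ⟨by omega⟩
  obtain ⟨A, C₀, hC₀, hadd, hnorm, hform⟩ := exists_forwardOperator (M := M) hn1 hΩ hE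
  have coer : ∀ σ ∈ AdmS Ω, ∀ ζ ∈ AdmZ Ω E, ∃ c : ℝ, 0 < c ∧
      ∀ x, c * ‖x‖ ^ 2 ≤ (inner ℂ x (A σ ζ x)).re := by
    intro σ hσ ζ hζ
    obtain ⟨c, hc, h⟩ := hζ.2 σ hσ
    refine ⟨c, hc, fun x => ?_⟩
    have hx := h (incl Ω M x)
    rwa [hform σ ζ hζ.1, norm_cls, proj_incl] at hx
  have solv : ∀ σ ∈ AdmS Ω, ∀ ζ ∈ AdmZ Ω E, ∀ I : diamond M,
      ∃ s : HQuot Ω M, ∀ t, IsSolution E σ ζ I t ↔ t = s := by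
    intro σ hσ ζ hζ I
    obtain ⟨c, hc, h⟩ := coer σ hσ ζ hζ
    obtain ⟨-, hb⟩ := bijective_of_coercive _ hc h
    obtain ⟨x, hx⟩ := hb.2 (current Ω I)
    exact ⟨_, isSolution_iff_eq (hform σ ζ hζ.1) hb.1 hx⟩
  have est : ∀ σ ∈ AdmS Ω, ∀ ζ ∈ AdmZ Ω E, ∃ δ : ℝ, 0 < δ ∧ ∃ C : ℝ, 0 < C ∧
      ∀ ω : Lp ℂ ∞ (vol Ω), ‖ω‖ ≤ δ → ∀ η ∈ LinfE Ω E, ‖η‖ ≤ δ → ∀ I J : diamond M,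
        ∃ s s' : HQuot Ω M,
          (∀ t, IsSolution E σ ζ I t ↔ t = s) ∧
          (∀ t, IsSolution E (σ + ω) (ζ + η) (I + J) t ↔ t = s') ∧
          IsElectrodePotential E (σ + ω) (ζ + η) (I + J)
            (measurementMap E (σ + ω) (ζ + η) (I + J)) ∧
          quotNorm (measurementMap E (σ + ω) (ζ + η) (I + J) - measurementMap E σ ζ I : Cn M)
            ≤ ‖s' - s‖ ∧
          ‖s' - s‖ ≤ C * (‖J‖ + max ‖ω‖ ‖η‖ * ‖I‖) ∧
          ‖measurementMap E (σ + ω) (ζ + η) (I + J) - measurementMap E σ ζ I‖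
            ≤ C * (‖J‖ + max ‖ω‖ ‖η‖ * ‖I‖) := by
    intro σ hσ ζ hζ
    obtain ⟨c, hc, h⟩ := coer σ hσ ζ hζ
    obtain ⟨-, hb⟩ := bijective_of_coercive _ hc h
    -- `δ` is such that `‖A ω η‖ ≤ c / 2`; the summand `1` covers the case `C₀ = 0`
    refine ⟨c / (2 * (C₀ + 1)), by positivity, 2 / c * (1 + C₀ / c), by positivity,
      fun ω hω η hηE hη I J => ?_⟩
    have hB : ‖A ω η‖ ≤ c / 2 :=
      calc ‖A ω η‖ ≤ C₀ * max ‖ω‖ ‖η‖ := hnorm ω η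
        _ ≤ (C₀ + 1) * (c / (2 * (C₀ + 1))) := by
          gcongr
          · linarith
          · exact max_le hω hη
        _ = c / 2 := by field_simp
    obtain ⟨hb', hest⟩ := norm_sub_le_of_coercive hc h hB
    obtain ⟨x, hx⟩ := hb.2 (current Ω I)
    obtain ⟨x', hx'⟩ := hb'.2 (current Ω (I + J))
    have hform' := hform (σ + ω) (ζ + η) (add_mem_LinfE hζ.1 hηE)
    rw [hadd] at hform'
    have hs := isSolution_iff_eq (hform σ ζ hζ.1) hb.1 hx
    have hs' := isSolution_iff_eq hform' hb'.1 hx'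
    have hU := isElectrodePotential_measurementMap hΩ hs
    have hU' := isElectrodePotential_measurementMap hΩ hs'
    have hq := quotNorm_sub_le hs hs' hU hU'
    refine (fun hle => ⟨_, _, hs, hs', hU', hq, hle, (norm_le_quotNorm _).trans (hq.trans hle)⟩) ?_
    have hd := hest x x' _ _ hx (hx'.trans (current_add I J))
    rw [norm_current, norm_current] at hd
    have e : ‖(HQuot.cls (incl Ω M x') - HQuot.cls (incl Ω M x) : HQuot Ω M)‖ = ‖x' - x‖ := by
      refine (norm_cls (incl Ω M x' - incl Ω M x)).trans ?_
      rw [map_sub, proj_incl, proj_incl]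
    rw [e]
    refine hd.trans ?_
    rw [mul_assoc]
    refine mul_le_mul_of_nonneg_left ?_ (by positivity)
    calc ‖J‖ + ‖A ω η‖ * (‖I‖ / c) ≤ ‖J‖ + C₀ * max ‖ω‖ ‖η‖ * (‖I‖ / c) := by
          gcongr; exact hnorm ω η
      _ = ‖J‖ + C₀ / c * (max ‖ω‖ ‖η‖ * ‖I‖) := by ring
      _ ≤ ‖J‖ + C₀ / c * (max ‖ω‖ ‖η‖ * ‖I‖) + (C₀ / c * ‖J‖ + max ‖ω‖ ‖η‖ * ‖I‖) :=
          le_add_of_nonneg_right (by positivity)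
      _ = (1 + C₀ / c) * (‖J‖ + max ‖ω‖ ‖η‖ * ‖I‖) := by ring
  refine ⟨fun σ hσ ζ hζ I => ?_, ?_, est⟩
  · obtain ⟨s, hs⟩ := solv σ hσ ζ hζ I
    exact ⟨⟨s, (hs s).2 rfl, fun t ht => (hs t).1 ht⟩, existsUnique_isElectrodePotential hΩ hs,
      isElectrodePotential_measurementMap hΩ hs⟩
  -- continuity is the estimate for `(ω, η, J) = (σ' - σ, ζ' - ζ, I' - I)`, which tends to `0`
  · rw [continuous_iff_continuousAt]
    rintro ⟨⟨σ, hσ⟩, ⟨ζ, hζ⟩, I⟩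
    obtain ⟨δ, hδ, C, hC, h⟩ := est σ hσ ζ hζ
    rw [ContinuousAt, tendsto_iff_norm_sub_tendsto_zero]
    let ω : AdmS Ω × AdmZ Ω E × diamond M → ℝ := fun p => ‖(p.1 : Lp ℂ ∞ (vol Ω)) - σ‖
    let η : AdmS Ω × AdmZ Ω E × diamond M → ℝ := fun p => ‖(p.2.1 : Lp ℂ ∞ (surf Ω)) - ζ‖
    have hω : Continuous ω := ((continuous_subtype_val.comp continuous_fst).sub
      continuous_const).norm
    have hη : Continuous η := ((continuous_subtype_val.comp
      (continuous_fst.comp continuous_snd)).sub continuous_const).norm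
    have hω0 : ω (⟨σ, hσ⟩, ⟨ζ, hζ⟩, I) = 0 := by simp [ω]
    have hη0 : η (⟨σ, hσ⟩, ⟨ζ, hζ⟩, I) = 0 := by simp [η]
    have hlim : Tendsto (fun p : AdmS Ω × AdmZ Ω E × diamond M =>
        C * (‖p.2.2 - I‖ + max (ω p) (η p) * ‖I‖)) (𝓝 (⟨σ, hσ⟩, ⟨ζ, hζ⟩, I)) (𝓝 0) := by
      have hc : Continuous fun p : AdmS Ω × AdmZ Ω E × diamond M =>
          C * (‖p.2.2 - I‖ + max (ω p) (η p) * ‖I‖) :=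
        continuous_const.mul ((((continuous_snd.comp continuous_snd).sub
          continuous_const).norm).add ((hω.max hη).mul continuous_const))
      simpa [hω0, hη0] using hc.tendsto (⟨σ, hσ⟩, ⟨ζ, hζ⟩, I)
    refine squeeze_zero' (Eventually.of_forall fun _ => norm_nonneg _) ?_ hlim
    filter_upwards [hω.continuousAt.eventually_lt_const (hω0.trans_lt hδ),
      hη.continuousAt.eventually_lt_const (hη0.trans_lt hδ)]
    rintro ⟨⟨σ', hσ'⟩, ⟨ζ', hζ'⟩, I'⟩ h1 h2
    obtain ⟨-, -, -, -, -, -, -, hle⟩ := h (σ' - σ) h1.le (ζ' - ζ) (sub_mem_LinfE hζ'.1 hζ.1)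
      h2.le I (I' - I)
    rwa [add_sub_cancel, add_sub_cancel, add_sub_cancel] at hle
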